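/- Let $n\in\{2,3\}$, let $W(s)=(s^2-1)^2/4$ and $c_0=\int_{-1}^1\sqrt{2W(s)}\,ds$. For a bounded open set $\Omega\subset\mathbb R^n$ let $X=X(\Omega)$ be the set of $u\in W^{2,2}_{loc}(\mathbb R^n)$ with $u=-1$ almost everywhere outside $\Omega$, and for $\varepsilon>0$ let $$\mathcal W_\varepsilon(u)=\frac1{c_0}\int_\Omega\frac1\varepsilon\Big(\varepsilon\,\Delta u-\frac1\varepsilon W'(u)\Big)^2dx\quad\text{for }u\in X,\qquad \mathcal W_\varepsilon(u)=+\infty\quad\text{otherwise.}$$ **Lemma.** For every $\bar\alpha\in[0,\infty)$ there is a constant $C$, depending only on $\bar\alpha$ and $n$, such that the following holds. Let $\Omega\subset\mathbb R^n$ be open and bounded, and let $(u_\varepsilon)_{\varepsilon>0}$ be a family in $X(\Omega)$ with $\limsup_{\varepsilon\to0}\mathcal W_\varepsilon(u_\varepsilon)\le\bar\alpha$. Then there is $\varepsilon_0>0$ such that for all $0<\varepsilon<\varepsilon_0$: 1. $\|u_\varepsilon\|_{L^\infty(\mathbb R^n)}\le C$; 2. $u_\varepsilon$ has a continuous representative,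 and this representative satisfies $$|u_\varepsilon(x)-u_\varepsilon(y)|\le\frac{C}{\sqrt\varepsilon}\,|x-y|^{1/2}\qquad\text{for all }x\in\mathbb R^n,\ y\in B(x,\varepsilon).$$ -/

import Mathlib

open Set Filter Topology MeasureTheory
open scoped NNReal ENNReal ContDiff

namespace PhaseField

/-- `g` is the weak partial derivative of `u` on `ℝⁿ` in the `i`-th coordinate direction:
both are locally integrable and `∫ u ∂ᵢφ = - ∫ g φ` for all smooth compactly supported `φ`. -/
def HasWeakPartialDeriv {n : ℕ} (i : Fin n) (u g : EuclideanSpace ℝ (Fin n) → ℝ) : Prop :=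
  LocallyIntegrable u volume ∧ LocallyIntegrable g volume ∧
    ∀ φ : EuclideanSpace ℝ (Fin n) → ℝ, ContDiff ℝ ∞ φ → HasCompactSupport φ →
      ∫ x, u x * fderiv ℝ φ x (EuclideanSpace.single i 1) = - ∫ x, g x * φ x

open Classical in
/-- A representative of the weak partial derivative (it is unique up to null sets);
`0` if there is no weak partial derivative. -/
noncomputable def weakPartialDeriv {n : ℕ} (i : Fin n) (u : EuclideanSpace ℝ (Fin n) → ℝ) :
    EuclideanSpace ℝ (Fin n) → ℝ :=
  if h : ∃ g, HasWeakPartialDeriv i u g then h.choose else 0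

/-- The weak Laplacian `∑ᵢ ∂ᵢ∂ᵢ u`. -/
noncomputable def weakLaplacian {n : ℕ} (u : EuclideanSpace ℝ (Fin n) → ℝ) :
    EuclideanSpace ℝ (Fin n) → ℝ :=
  fun x => ∑ i, weakPartialDeriv i (weakPartialDeriv i u) x

/-- `u ∈ L²_loc(ℝⁿ)`. -/
def MemL2Loc {n : ℕ} (u : EuclideanSpace ℝ (Fin n) → ℝ) : Prop :=
  ∀ K : Set (EuclideanSpace ℝ (Fin n)), IsCompact K → MemLp u 2 (volume.restrict K)

/-- `u ∈ W^{2,2}_loc(ℝⁿ)`: `u` and all its weak partial derivatives of first and second order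
exist and lie in `L²_loc(ℝⁿ)`. -/
def MemW22Loc {n : ℕ} (u : EuclideanSpace ℝ (Fin n) → ℝ) : Prop :=
  MemL2Loc u ∧ ∃ (g : Fin n → EuclideanSpace ℝ (Fin n) → ℝ)
      (h : Fin n → Fin n → EuclideanSpace ℝ (Fin n) → ℝ),
    (∀ i, MemL2Loc (g i) ∧ HasWeakPartialDeriv i u (g i)) ∧
    (∀ i j, MemL2Loc (h i j) ∧ HasWeakPartialDeriv j (g i) (h i j))

/-- The space `X` of functions in `W^{2,2}_loc(ℝⁿ)` with `u ≡ -1` (almost everywhere)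
outside `Ω`. -/
def phaseFieldSpace {n : ℕ} (Ω : Set (EuclideanSpace ℝ (Fin n))) :
    Set (EuclideanSpace ℝ (Fin n) → ℝ) :=
  {u | MemW22Loc u ∧ ∀ᵐ x ∂volume, x ∉ Ω → u x = -1}

/-- The double-well potential `W(s) = (s² - 1)² / 4`. -/
noncomputable def doubleWell (s : ℝ) : ℝ := (s ^ 2 - 1) ^ 2 / 4

/-- The normalising constant `c₀ = ∫_{-1}^{1} √(2 W(s)) ds`. -/
noncomputable def surfaceConst : ℝ := ∫ s in (-1 : ℝ)..1, √(2 * doubleWell s)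

open Classical in
/-- The diffuse Willmore functional
`𝒲_ε(u) = (1 / c₀) ∫_Ω (1 / ε) (ε Δu - W'(u) / ε)² dx` for `u ∈ X`, and `+∞` otherwise. -/
noncomputable def diffuseWillmore {n : ℕ} (Ω : Set (EuclideanSpace ℝ (Fin n))) (ε : ℝ)
    (u : EuclideanSpace ℝ (Fin n) → ℝ) : ℝ≥0∞ :=
  if u ∈ phaseFieldSpace Ω then
    ENNReal.ofReal (1 / surfaceConst) *
      ∫⁻ x in Ω, ENNReal.ofReal
        (1 / ε * (ε * weakLaplacian u x - 1 / ε * deriv doubleWell (u x)) ^ 2)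
  else ⊤

end PhaseField

/-! Write `f = Δu - ε⁻²(u³ - u)`. The energy bound says that `ε ∫ f²` is bounded, and this integral
may be taken over all of `ℝⁿ`: outside `Ω` one has `u = -1`, a zero of `W'`, and weak derivatives
vanish almost everywhere on level sets. The blow-up `V(z) = u(εz)` solves `ΔV = V³ - V + ε² f(ε·)`,
and the squared `L²` norm of the last term is `ε^(4-n) ∫ f² ≤ ε ∫ f²` for `n ≤ 3` and `ε ≤ 1`. So it
suffices to prove a sup bound and a Hölder-1/2 bound at unit scale, depending only on the `L²` norm
of the forcing.

Both bounds come from Gaussian averages `gaussAvg r v x = E v(x + rZ)`. They satisfy `∂ᵣ gaussAvg r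
v = r gaussAvg r Δv` (`hasDerivAt_gaussAvg`), so `v(x)` is recovered from its average at width 1 and
the averages of `Δv` at widths in `(0, 1)`. By Cauchy–Schwarz, an `L²` function averaged at width
`r` costs `r^(-n/2)`; the weight `r` leaves the integrable power `r^(-1/2)` when `n ≤ 3`.

The sup bound (`exists_abs_le_of_laplacian_eq_cubic`) uses the good sign of the cubic. For `w = √(1
+ v²)`, convexity gives `w ≤ Δw + 2 + η + |f|`, and damping the averages by `exp(-r²/2)` yields `w ≤
e^(-1/2) sup w + const`, where the supremum is absorbed. Once `v` is bounded, `Δv` is a bounded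
function plus an `L²` function, and the Hölder bound (`exists_holder_of_laplacian`) follows by
comparing averages at two points, splitting the widths at `|x - y|`.

These estimates are for smooth functions. A `W^{2,2}` function is mollified, which commutes with the
Laplacian but not with the cubic. A preliminary, non-uniform regularity step supplies a continuous
representative; the commutator then tends to zero uniformly and is carried as the error `η`. -/

namespace PhaseField

/-! ### Gaussian kernel: integrability and the cost of translations in `L¹` and `L²` -/

section Gaussian

variable {n : ℕ}

/-- Cauchy–Schwarz for square integrable real functions. -/
theorem abs_integral_mul_le_sqrt {α : Type*} [MeasurableSpace α] {μ : Measure α} {f g : α → ℝ}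
    (hf : AEStronglyMeasurable f μ) (hg : AEStronglyMeasurable g μ)
    (hf2 : Integrable (fun x => f x ^ 2) μ) (hg2 : Integrable (fun x => g x ^ 2) μ) :
    ∫ x, |f x * g x| ∂μ ≤ √(∫ x, f x ^ 2 ∂μ) * √(∫ x, g x ^ 2 ∂μ) := by
  have h := integral_mul_le_Lp_mul_Lq_of_nonneg (μ := μ) (p := 2) (q := 2)
    (f := fun x => |f x|) (g := fun x => |g x|) Real.HolderConjugate.two_two
    (ae_of_all _ fun x => abs_nonneg _) (ae_of_all _ fun x => abs_nonneg _)
    (by rw [ENNReal.ofReal_ofNat]; exact ((memLp_two_iff_integrable_sq hf).2 hf2).abs)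
    (by rw [ENNReal.ofReal_ofNat]; exact ((memLp_two_iff_integrable_sq hg).2 hg2).abs)
  simpa [abs_mul, Real.sqrt_eq_rpow] using h

theorem integrable_exp_neg_mul_norm_sq {b : ℝ} (hb : 0 < b) :
    Integrable (fun z : EuclideanSpace ℝ (Fin n) => Real.exp (-b * ‖z‖ ^ 2)) := by
  -- A non-integrable function would have integral `0`, while the closed formula is positive.
  by_contra h
  have h1 := GaussianFourier.integral_rexp_neg_mul_sq_norm (V := EuclideanSpace ℝ (Fin n)) hb
  rw [integral_undef h] at h1
  have : 0 < (Real.pi / b) ^ ((Module.finrank ℝ (EuclideanSpace ℝ (Fin n)) : ℝ) / 2) := by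
    positivity
  exact this.ne h1

/-- Translating a Gaussian by `a` changes it by `O(‖a‖)` in `L²`. -/
theorem integral_sq_exp_sub_exp_le {b : ℝ} (hb : 0 < b) (a : EuclideanSpace ℝ (Fin n)) :
    Integrable (fun z : EuclideanSpace ℝ (Fin n) =>
      (Real.exp (-b * ‖z - a‖ ^ 2) - Real.exp (-b * ‖z‖ ^ 2)) ^ 2) ∧
    ∫ z : EuclideanSpace ℝ (Fin n), (Real.exp (-b * ‖z - a‖ ^ 2) - Real.exp (-b * ‖z‖ ^ 2)) ^ 2
      ≤ (∫ z : EuclideanSpace ℝ (Fin n), Real.exp (-(2 * b) * ‖z‖ ^ 2)) * (b * ‖a‖ ^ 2) := by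
  set I := ∫ z : EuclideanSpace ℝ (Fin n), Real.exp (-(2 * b) * ‖z‖ ^ 2) with hI
  have hint := integrable_exp_neg_mul_norm_sq (n := n) (b := 2 * b) (by positivity)
  have hI0 : 0 ≤ I := integral_nonneg fun z => (Real.exp_pos _).le
  -- By the parallelogram law the cross term is a Gaussian centred at `a / 2` times `exp(-b‖a‖²/2)`.
  -- Integration therefore gives `2 I (1 - exp(-b‖a‖²/2))`, and `1 - exp(-t) ≤ t` concludes.
  have key : ∀ z : EuclideanSpace ℝ (Fin n),
      (Real.exp (-b * ‖z - a‖ ^ 2) - Real.exp (-b * ‖z‖ ^ 2)) ^ 2 =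
      Real.exp (-(2 * b) * ‖z - a‖ ^ 2) + Real.exp (-(2 * b) * ‖z‖ ^ 2)
        - 2 * Real.exp (-(b / 2) * ‖a‖ ^ 2) *
          Real.exp (-(2 * b) * ‖z - (2⁻¹ : ℝ) • a‖ ^ 2) := by
    intro z
    have h1 : Real.exp (-(2 * b) * ‖z - a‖ ^ 2) = Real.exp (-b * ‖z - a‖ ^ 2) ^ 2 := by
      rw [← Real.exp_nat_mul]; congr 1; push_cast; ring
    have h2 : Real.exp (-(2 * b) * ‖z‖ ^ 2) = Real.exp (-b * ‖z‖ ^ 2) ^ 2 := by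
      rw [← Real.exp_nat_mul]; congr 1; push_cast; ring
    have h3 : Real.exp (-(b / 2) * ‖a‖ ^ 2) *
          Real.exp (-(2 * b) * ‖z - (2⁻¹ : ℝ) • a‖ ^ 2) =
        Real.exp (-b * ‖z - a‖ ^ 2) * Real.exp (-b * ‖z‖ ^ 2) := by
      rw [← Real.exp_add, ← Real.exp_add]
      congr 1
      rw [norm_sub_sq_real, norm_sub_sq_real, norm_smul, inner_smul_right]
      norm_num
      ring
    rw [h1, h2, mul_assoc, h3]; ring
  simp_rw [key]
  have i1 := hint.comp_sub_right a
  have i2 := (hint.comp_sub_right ((2⁻¹ : ℝ) • a)).const_mul (2 * Real.exp (-(b / 2) * ‖a‖ ^ 2))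
  have i3 : Integrable (fun z : EuclideanSpace ℝ (Fin n) =>
      Real.exp (-(2 * b) * ‖z - a‖ ^ 2) + Real.exp (-(2 * b) * ‖z‖ ^ 2)) := i1.add hint
  refine ⟨i3.sub i2, ?_⟩
  rw [integral_sub i3 i2, integral_add i1 hint, integral_const_mul,
    integral_sub_right_eq_self (fun z : EuclideanSpace ℝ (Fin n) =>
      Real.exp (-(2 * b) * ‖z‖ ^ 2)) a,
    integral_sub_right_eq_self (fun z : EuclideanSpace ℝ (Fin n) =>
      Real.exp (-(2 * b) * ‖z‖ ^ 2)), ← hI]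
  have := Real.add_one_le_exp (-(b / 2) * ‖a‖ ^ 2)
  nlinarith

/-- The normalising constant of `gauss`. -/
noncomputable def gaussConst (n : ℕ) : ℝ :=
  ∫ z : EuclideanSpace ℝ (Fin n), Real.exp (-(1 / 2) * ‖z‖ ^ 2)

theorem gaussConst_pos : 0 < gaussConst n := by
  rw [gaussConst, GaussianFourier.integral_rexp_neg_mul_sq_norm (by norm_num)]
  positivity

/-- The density of the standard Gaussian on `ℝⁿ`. -/
noncomputable def gauss (z : EuclideanSpace ℝ (Fin n)) : ℝ :=
  (gaussConst n)⁻¹ * Real.exp (-(1 / 2) * ‖z‖ ^ 2)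

theorem gauss_nonneg (z : EuclideanSpace ℝ (Fin n)) : 0 ≤ gauss z :=
  mul_nonneg (inv_nonneg.2 gaussConst_pos.le) (Real.exp_pos _).le

theorem integrable_gauss : Integrable (gauss (n := n)) :=
  (integrable_exp_neg_mul_norm_sq (by norm_num)).const_mul _

theorem integral_gauss : ∫ z, gauss (n := n) z = 1 := by
  simp only [gauss, integral_const_mul]
  exact inv_mul_cancel₀ gaussConst_pos.ne'

theorem hasFDerivAt_gauss (z : EuclideanSpace ℝ (Fin n)) :
    HasFDerivAt (gauss (n := n)) (-(gauss z • innerSL ℝ z)) z := by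
  have h1 : HasFDerivAt (fun z : EuclideanSpace ℝ (Fin n) => ‖z‖ ^ 2) (2 • innerSL ℝ z) z :=
    (hasStrictFDerivAt_norm_sq z).hasFDerivAt
  have h2 := ((h1.const_mul (-(1 / 2))).exp).const_mul (gaussConst n)⁻¹
  refine HasFDerivAt.congr_fderiv (f := gauss) h2 ?_
  ext v
  simp [gauss]
  ring

theorem continuous_gauss : Continuous (gauss (n := n)) :=
  continuous_iff_continuousAt.2 fun z => (hasFDerivAt_gauss z).continuousAt

theorem integrable_norm_mul_gauss :
    Integrable (fun z : EuclideanSpace ℝ (Fin n) => ‖z‖ * gauss z) := by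
  refine (((integrable_exp_neg_mul_norm_sq (n := n) (b := 1 / 4) (by norm_num)).const_mul
    (2 * (gaussConst n)⁻¹))).mono' (continuous_norm.mul continuous_gauss).aestronglyMeasurable
    (ae_of_all _ fun z => ?_)
  rw [Real.norm_of_nonneg (mul_nonneg (norm_nonneg _) (gauss_nonneg z)), gauss]
  have h1 : Real.exp (-(1 / 2) * ‖z‖ ^ 2) =
      Real.exp (-(1 / 4) * ‖z‖ ^ 2) * Real.exp (-(1 / 4) * ‖z‖ ^ 2) := by
    rw [← Real.exp_add]; congr 1; ring
  have h2 : ‖z‖ * Real.exp (-(1 / 4) * ‖z‖ ^ 2) ≤ 2 := by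
    have h3 := Real.add_one_le_exp (1 / 4 * ‖z‖ ^ 2)
    have h4 : Real.exp (1 / 4 * ‖z‖ ^ 2) * Real.exp (-(1 / 4) * ‖z‖ ^ 2) = 1 := by
      rw [← Real.exp_add]; norm_num
    have h5 : ‖z‖ ≤ 2 * Real.exp (1 / 4 * ‖z‖ ^ 2) := by nlinarith [sq_nonneg (‖z‖ - 1)]
    calc _ ≤ 2 * Real.exp (1 / 4 * ‖z‖ ^ 2) * Real.exp (-(1 / 4) * ‖z‖ ^ 2) := by gcongr
      _ = 2 := by rw [mul_assoc, h4, mul_one]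
  rw [h1]
  have := mul_le_mul_of_nonneg_right h2 (mul_nonneg (inv_nonneg.2 (gaussConst_pos (n := n)).le)
    (Real.exp_pos (-(1 / 4) * ‖z‖ ^ 2)).le)
  linarith

theorem integrable_gauss_sq : Integrable (fun z => gauss (n := n) z ^ 2) := by
  have := (integrable_exp_neg_mul_norm_sq (n := n) (b := 1) (by norm_num)).const_mul
    ((gaussConst n)⁻¹ ^ 2)
  refine this.congr (ae_of_all _ fun z => ?_)
  simp only [gauss, mul_pow]
  rw [← Real.exp_nat_mul]
  congr 2; push_cast; ring

/-- Translating `gauss` by `a` changes it by `O(‖a‖)` in `L²`. -/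
theorem exists_integral_sq_gauss_sub_le (n : ℕ) : ∃ K : ℝ, 0 ≤ K ∧
    ∀ a : EuclideanSpace ℝ (Fin n),
      Integrable (fun z => (gauss (z - a) - gauss z) ^ 2) ∧
      ∫ z, (gauss (z - a) - gauss z) ^ 2 ≤ (K * ‖a‖) ^ 2 := by
  have h0 : 0 ≤ ∫ z : EuclideanSpace ℝ (Fin n), Real.exp (-(2 * (1 / 2)) * ‖z‖ ^ 2) :=
    integral_nonneg fun z => (Real.exp_pos _).le
  refine ⟨(gaussConst n)⁻¹ * √((∫ z : EuclideanSpace ℝ (Fin n),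
    Real.exp (-(2 * (1 / 2)) * ‖z‖ ^ 2)) * (1 / 2)), ?_, fun a => ?_⟩
  · have := gaussConst_pos (n := n)
    positivity
  obtain ⟨h1, h2⟩ := integral_sq_exp_sub_exp_le (n := n) (b := 1 / 2) (by norm_num) a
  have h3 : ∀ z : EuclideanSpace ℝ (Fin n), (gauss (z - a) - gauss z) ^ 2 =
      (gaussConst n)⁻¹ ^ 2 *
        (Real.exp (-(1 / 2) * ‖z - a‖ ^ 2) - Real.exp (-(1 / 2) * ‖z‖ ^ 2)) ^ 2 := by
    intro z; simp only [gauss]; ring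
  simp_rw [h3]
  refine ⟨h1.const_mul _, ?_⟩
  rw [integral_const_mul, mul_pow, mul_pow, Real.sq_sqrt (by positivity), mul_assoc]
  gcongr
  linarith

/-- Translating `gauss` by `a` changes it by `O(‖a‖)` in `L¹`. -/
theorem exists_integral_abs_gauss_sub_le (n : ℕ) : ∃ K : ℝ, 0 ≤ K ∧
    ∀ a : EuclideanSpace ℝ (Fin n), ∫ z, |gauss (z - a) - gauss z| ≤ K * ‖a‖ := by
  set I := ∫ z : EuclideanSpace ℝ (Fin n), Real.exp (-(2 * (1 / 4)) * ‖z‖ ^ 2) with hI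
  have hint := integrable_exp_neg_mul_norm_sq (n := n) (b := 2 * (1 / 4)) (by norm_num)
  have h0 : 0 ≤ I := integral_nonneg fun z => (Real.exp_pos _).le
  have hc := gaussConst_pos (n := n)
  refine ⟨(gaussConst n)⁻¹ * (√(I * (1 / 4)) * √(4 * I)), by positivity, fun a => ?_⟩
  obtain ⟨h1, h2⟩ := integral_sq_exp_sub_exp_le (n := n) (b := 1 / 4) (by norm_num) a
  have hsq : ∀ z : EuclideanSpace ℝ (Fin n), Real.exp (-(2 * (1 / 4)) * ‖z‖ ^ 2) =
      Real.exp (-(1 / 4) * ‖z‖ ^ 2) ^ 2 := by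
    intro z; rw [← Real.exp_nat_mul]; congr 1; push_cast; ring
  -- The Gaussian is the square of one of half the exponent, so the difference factors as `p² - q² =
  -- (p - q)(p + q)`. Cauchy–Schwarz then reduces the `L¹` bound to the `L²` bound for `p - q`.
  have h3 : ∀ z : EuclideanSpace ℝ (Fin n), |gauss (z - a) - gauss z| =
      (gaussConst n)⁻¹ *
        |(Real.exp (-(1 / 4) * ‖z - a‖ ^ 2) - Real.exp (-(1 / 4) * ‖z‖ ^ 2)) *
          (Real.exp (-(1 / 4) * ‖z - a‖ ^ 2) + Real.exp (-(1 / 4) * ‖z‖ ^ 2))| := by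
    intro z
    conv_rhs => rw [← abs_of_pos (inv_pos.2 hc), ← abs_mul]
    congr 1
    have h4 := hsq z
    have h5 := hsq (z - a)
    norm_num at h4 h5
    simp only [gauss]
    norm_num
    rw [h4, h5]; ring
  have i1 := hint.comp_sub_right a
  have hle : ∀ z : EuclideanSpace ℝ (Fin n),
      (Real.exp (-(1 / 4) * ‖z - a‖ ^ 2) + Real.exp (-(1 / 4) * ‖z‖ ^ 2)) ^ 2 ≤
      2 * (Real.exp (-(2 * (1 / 4)) * ‖z - a‖ ^ 2) +
        Real.exp (-(2 * (1 / 4)) * ‖z‖ ^ 2)) := by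
    intro z
    rw [hsq, hsq]
    nlinarith [sq_nonneg (Real.exp (-(1 / 4) * ‖z - a‖ ^ 2) - Real.exp (-(1 / 4) * ‖z‖ ^ 2))]
  have i3 : Integrable (fun z : EuclideanSpace ℝ (Fin n) =>
      2 * (Real.exp (-(2 * (1 / 4)) * ‖z - a‖ ^ 2) +
        Real.exp (-(2 * (1 / 4)) * ‖z‖ ^ 2))) := (i1.add hint).const_mul 2
  have i2 : Integrable (fun z : EuclideanSpace ℝ (Fin n) =>
      (Real.exp (-(1 / 4) * ‖z - a‖ ^ 2) + Real.exp (-(1 / 4) * ‖z‖ ^ 2)) ^ 2) := by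
    refine i3.mono' (by fun_prop) (ae_of_all _ fun z => ?_)
    rw [Real.norm_of_nonneg (sq_nonneg _)]
    exact hle z
  have h4 : ∫ z : EuclideanSpace ℝ (Fin n),
      (Real.exp (-(1 / 4) * ‖z - a‖ ^ 2) + Real.exp (-(1 / 4) * ‖z‖ ^ 2)) ^ 2 ≤ 4 * I := by
    refine (integral_mono i2 i3 hle).trans ?_
    rw [integral_const_mul, integral_add i1 hint,
      integral_sub_right_eq_self (fun z : EuclideanSpace ℝ (Fin n) =>
      Real.exp (-(2 * (1 / 4)) * ‖z‖ ^ 2)) a, ← hI]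
    linarith
  simp_rw [h3]
  rw [integral_const_mul, mul_assoc]
  gcongr
  refine (abs_integral_mul_le_sqrt (by fun_prop) (by fun_prop) h1 i2).trans ?_
  calc _ ≤ √(I * (1 / 4 * ‖a‖ ^ 2)) * √(4 * I) := by gcongr
    _ = _ := by
      rw [← mul_assoc I, Real.sqrt_mul (by positivity), Real.sqrt_sq (norm_nonneg _)]
      ring

end Gaussian

/-! ### Gaussian averages: scaling estimates and the heat equation in the width -/

section GaussAvg

variable {n : ℕ}

/-- The Laplacian `∑ᵢ ∂ᵢ∂ᵢ v` of a smooth function. -/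
noncomputable def laplacian (v : EuclideanSpace ℝ (Fin n) → ℝ) (x : EuclideanSpace ℝ (Fin n)) : ℝ :=
  ∑ i, fderiv ℝ (fun y => fderiv ℝ v y (EuclideanSpace.single i 1)) x (EuclideanSpace.single i 1)

/-- The average `∫ h (x + r z) dγ(z)` with respect to the standard Gaussian measure. -/
noncomputable def gaussAvg (r : ℝ) (h : EuclideanSpace ℝ (Fin n) → ℝ)
    (x : EuclideanSpace ℝ (Fin n)) : ℝ :=
  ∫ z, gauss z * h (x + r • z)

variable {h k v : EuclideanSpace ℝ (Fin n) → ℝ} {c B : ℝ}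

theorem integrable_mul_comp_of_bounded (hk : Integrable k) (hh : Continuous h)
    (hB : ∀ x, |h x| ≤ B) (x : EuclideanSpace ℝ (Fin n)) (r : ℝ) :
    Integrable fun z => k z * h (x + r • z) :=
  hk.mul_bdd (c := B) (by fun_prop) (ae_of_all _ fun z => hB _)

theorem continuous_gaussAvg (hh : Continuous h) (hB : ∀ x, |h x| ≤ B)
    (x : EuclideanSpace ℝ (Fin n)) : Continuous fun r => gaussAvg r h x := by
  have := continuous_gauss (n := n)
  refine continuous_of_dominated (bound := fun z => gauss z * B) (fun r => by fun_prop)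
    (fun r => ae_of_all _ fun z => ?_) (integrable_gauss.mul_const B)
    (ae_of_all _ fun z => by fun_prop)
  rw [norm_mul, Real.norm_of_nonneg (gauss_nonneg z)]
  exact mul_le_mul_of_nonneg_left (hB _) (gauss_nonneg z)

theorem gaussAvg_mono {h' : EuclideanSpace ℝ (Fin n) → ℝ} {B' : ℝ}
    (hh : Continuous h) (hB : ∀ x, |h x| ≤ B)
    (hh' : Continuous h') (hB' : ∀ x, |h' x| ≤ B') (hle : ∀ x, h x ≤ h' x) (r : ℝ)
    (x : EuclideanSpace ℝ (Fin n)) : gaussAvg r h x ≤ gaussAvg r h' x :=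
  integral_mono (integrable_mul_comp_of_bounded integrable_gauss hh hB x r)
    (integrable_mul_comp_of_bounded integrable_gauss hh' hB' x r)
    fun _ => mul_le_mul_of_nonneg_left (hle _) (gauss_nonneg _)

theorem gaussAvg_add {h' : EuclideanSpace ℝ (Fin n) → ℝ} {B' : ℝ}
    (hh : Continuous h) (hB : ∀ x, |h x| ≤ B)
    (hh' : Continuous h') (hB' : ∀ x, |h' x| ≤ B') (r : ℝ)
    (x : EuclideanSpace ℝ (Fin n)) :
    gaussAvg r (fun y => h y + h' y) x = gaussAvg r h x + gaussAvg r h' x := by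
  simp only [gaussAvg, mul_add]
  exact integral_add (integrable_mul_comp_of_bounded integrable_gauss hh hB x r)
    (integrable_mul_comp_of_bounded integrable_gauss hh' hB' x r)

theorem gaussAvg_const (r : ℝ) (x : EuclideanSpace ℝ (Fin n)) :
    gaussAvg r (fun _ => c) x = c := by
  simp [gaussAvg, integral_mul_const, integral_gauss]

theorem gaussAvg_zero (x : EuclideanSpace ℝ (Fin n)) : gaussAvg 0 h x = h x := by
  simp [gaussAvg, integral_mul_const, integral_gauss]

/-- Translation invariance moves the difference onto the kernel, so comparing averages at two points
needs no modulus of continuity of `h`. -/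
theorem gaussAvg_sub_gaussAvg (hh : Continuous h) (hB : ∀ x, |h x| ≤ B) {r : ℝ} (hr : r ≠ 0)
    (x y : EuclideanSpace ℝ (Fin n)) :
    gaussAvg r h x - gaussAvg r h y =
      ∫ z, (gauss (z - r⁻¹ • (x - y)) - gauss z) * h (y + r • z) := by
  have h1 : gaussAvg r h x = ∫ z, gauss (z - r⁻¹ • (x - y)) * h (y + r • z) := by
    rw [gaussAvg, ← integral_sub_right_eq_self _ (r⁻¹ • (x - y))]
    congr 1; ext z
    congr 2
    rw [smul_sub, smul_smul, mul_inv_cancel₀ hr, one_smul]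
    abel
  rw [h1, gaussAvg, ← integral_sub
    (integrable_mul_comp_of_bounded (integrable_gauss.comp_sub_right _) hh hB y r)
    (integrable_mul_comp_of_bounded integrable_gauss hh hB y r)]
  simp only [sub_mul]

/-- Cauchy–Schwarz; the factor `√((r ^ n)⁻¹)` is the Jacobian of `z ↦ y + r z` in the norm of `h`.
It is applied both to the kernel and to differences of translated kernels. -/
theorem abs_integral_mul_comp_le (hk : AEStronglyMeasurable k)
    (hk2 : Integrable fun z => k z ^ 2) {A : ℝ} (hA : 0 ≤ A) (hkA : ∫ z, k z ^ 2 ≤ A ^ 2)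
    (hh : Continuous h) (hhc : HasCompactSupport h) {N : ℝ} (hN : 0 ≤ N)
    (hhN : ∫ z, h z ^ 2 ≤ N ^ 2) {r : ℝ} (hr : 0 < r) (y : EuclideanSpace ℝ (Fin n)) :
    |∫ z, k z * h (y + r • z)| ≤ A * N * √((r ^ n)⁻¹) := by
  have hcont : Continuous fun z => h z ^ 2 := hh.pow 2
  have hi : Integrable fun z => h z ^ 2 :=
    hcont.integrable_of_hasCompactSupport (hhc.comp_left (g := fun t : ℝ => t ^ 2) (by simp))
  have hi2 : Integrable fun z => h (y + r • z) ^ 2 := by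
    have := (hi.comp_add_left y).comp_smul hr.ne'
    exact this
  have hv : ∫ z, h (y + r • z) ^ 2 = (r ^ n)⁻¹ * ∫ z, h z ^ 2 := by
    have h1 := Measure.integral_comp_smul volume
      (fun z : EuclideanSpace ℝ (Fin n) => h (y + z) ^ 2) r
    rw [h1, integral_add_left_eq_self (fun z : EuclideanSpace ℝ (Fin n) => h z ^ 2) y,
      finrank_euclideanSpace_fin, abs_of_pos (by positivity), smul_eq_mul]
  calc |∫ z, k z * h (y + r • z)| ≤ ∫ z, |k z * h (y + r • z)| := abs_integral_le_integral_abs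
    _ ≤ √(∫ z, k z ^ 2) * √(∫ z, h (y + r • z) ^ 2) :=
        abs_integral_mul_le_sqrt hk (by fun_prop) hk2 hi2
    _ ≤ A * (√((r ^ n)⁻¹) * N) := by
        rw [hv, Real.sqrt_mul (by positivity)]
        gcongr
        · exact Real.sqrt_le_iff.2 ⟨hA, hkA⟩
        · exact Real.sqrt_le_iff.2 ⟨hN, hhN⟩
    _ = _ := by ring

/-- The restriction on the dimension enters here: `1 - n/2 ≥ -1/2`, which makes the power integrable
at `0`. -/
theorem mul_sqrt_inv_pow_le (hn : n ≤ 3) {r : ℝ} (hr : 0 < r) (hr1 : r ≤ 1) :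
    r * √((r ^ n)⁻¹) ≤ r ^ (-(1 / 2) : ℝ) := by
  have h1 : √((r ^ n)⁻¹) ≤ √((r ^ 3)⁻¹) := by
    exact Real.sqrt_le_sqrt (inv_anti₀ (by positivity) (pow_le_pow_of_le_one hr.le hr1 hn))
  refine (mul_le_mul_of_nonneg_left h1 hr.le).trans (le_of_eq ?_)
  rw [Real.sqrt_eq_rpow, Real.inv_rpow (by positivity), ← Real.rpow_natCast, ← Real.rpow_mul hr.le,
    ← Real.rpow_neg hr.le]
  nth_rewrite 1 [← Real.rpow_one r]
  rw [← Real.rpow_add hr]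
  norm_num

/-- In dimension at most three, Gaussian averages of square integrable functions are controlled
by an integrable power of the width. -/
theorem exists_mul_abs_gaussAvg_le (n : ℕ) (hn : n ≤ 3) : ∃ K : ℝ, 0 ≤ K ∧
    ∀ h : EuclideanSpace ℝ (Fin n) → ℝ, Continuous h → HasCompactSupport h →
    ∀ N : ℝ, 0 ≤ N → ∫ z, h z ^ 2 ≤ N ^ 2 → ∀ r : ℝ, 0 < r → r ≤ 1 → ∀ x,
      r * |gaussAvg r h x| ≤ K * N * r ^ (-(1 / 2) : ℝ) := by
  refine ⟨√(∫ z, gauss (n := n) z ^ 2), Real.sqrt_nonneg _, fun h hh hhc N hN hhN r hr hr1 x => ?_⟩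
  have h1 := abs_integral_mul_comp_le continuous_gauss.aestronglyMeasurable
    (integrable_gauss_sq (n := n)) (Real.sqrt_nonneg _)
    (Real.sq_sqrt (integral_nonneg fun z => sq_nonneg _)).ge hh hhc hN hhN hr x
  calc _ ≤ r * (√(∫ z, gauss (n := n) z ^ 2) * N * √((r ^ n)⁻¹)) := by
        gcongr; exact h1
    _ = √(∫ z, gauss (n := n) z ^ 2) * N * (r * √((r ^ n)⁻¹)) := by ring
    _ ≤ _ := by gcongr; exact mul_sqrt_inv_pow_le hn hr hr1

/-- In units of the width the kernel is shifted by `|x - y| / r`, which gains that factor over the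
bound for a single average. The gain is useful only for `r ≥ |x - y|`. -/
theorem exists_mul_abs_gaussAvg_sub_le (n : ℕ) (hn : n ≤ 3) : ∃ K : ℝ, 0 ≤ K ∧
    ∀ h : EuclideanSpace ℝ (Fin n) → ℝ, Continuous h → HasCompactSupport h →
    ∀ N : ℝ, 0 ≤ N → ∫ z, h z ^ 2 ≤ N ^ 2 → ∀ r : ℝ, 0 < r → r ≤ 1 → ∀ x y,
      r * |gaussAvg r h x - gaussAvg r h y| ≤ K * N * (dist x y * r ^ (-(3 / 2) : ℝ)) := by
  obtain ⟨K, hK, hKa⟩ := exists_integral_sq_gauss_sub_le n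
  refine ⟨K, hK, fun h hh hhc N hN hhN r hr hr1 x y => ?_⟩
  obtain ⟨B, hB⟩ := hhc.exists_bound_of_continuous hh
  obtain ⟨i1, i2⟩ := hKa (r⁻¹ • (x - y))
  have hg := continuous_gauss (n := n)
  have h1 := abs_integral_mul_comp_le (by fun_prop) i1 (by positivity) i2 hh hhc hN hhN hr y
  rw [gaussAvg_sub_gaussAvg hh hB hr.ne']
  have h2 : ‖r⁻¹ • (x - y)‖ = r⁻¹ * dist x y := by
    rw [norm_smul, Real.norm_of_nonneg (by positivity), dist_eq_norm]
  have h3 : r⁻¹ * r ^ (-(1 / 2) : ℝ) = r ^ (-(3 / 2) : ℝ) := by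
    rw [← Real.rpow_neg_one, ← Real.rpow_add hr]; norm_num
  calc _ ≤ r * (K * ‖r⁻¹ • (x - y)‖ * N * √((r ^ n)⁻¹)) := by gcongr
    _ = K * N * (dist x y * (r⁻¹ * (r * √((r ^ n)⁻¹)))) := by rw [h2]; ring
    _ ≤ K * N * (dist x y * (r⁻¹ * r ^ (-(1 / 2) : ℝ))) := by
        gcongr; exact mul_sqrt_inv_pow_le hn hr hr1
    _ = _ := by rw [h3]

theorem exists_abs_gaussAvg_sub_le (n : ℕ) : ∃ K : ℝ, 0 ≤ K ∧
    ∀ h : EuclideanSpace ℝ (Fin n) → ℝ, Continuous h → ∀ B : ℝ, (∀ x, |h x| ≤ B) →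
    ∀ r : ℝ, 0 < r → ∀ x y, r * |gaussAvg r h x - gaussAvg r h y| ≤ K * B * dist x y := by
  obtain ⟨K, hK, hKa⟩ := exists_integral_abs_gauss_sub_le n
  refine ⟨K, hK, fun h hh B hB r hr x y => ?_⟩
  have hB0 : 0 ≤ B := (abs_nonneg _).trans (hB 0)
  rw [gaussAvg_sub_gaussAvg hh hB hr.ne']
  have i1 : Integrable fun z => |gauss (z - r⁻¹ • (x - y)) - gauss z| :=
    ((integrable_gauss.comp_sub_right _).sub integrable_gauss).abs
  have h1 : |∫ z, (gauss (z - r⁻¹ • (x - y)) - gauss z) * h (y + r • z)| ≤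
      ∫ z, |gauss (z - r⁻¹ • (x - y)) - gauss z| * B := by
    refine norm_integral_le_of_norm_le
      (f := fun z => (gauss (z - r⁻¹ • (x - y)) - gauss z) * h (y + r • z))
      (i1.mul_const B) (ae_of_all _ fun z => ?_)
    rw [norm_mul]
    exact mul_le_mul_of_nonneg_left (hB _) (abs_nonneg _)
  rw [integral_mul_const] at h1
  have h2 : ‖r⁻¹ • (x - y)‖ = r⁻¹ * dist x y := by
    rw [norm_smul, Real.norm_of_nonneg (by positivity), dist_eq_norm]
  calc _ ≤ r * (K * ‖r⁻¹ • (x - y)‖ * B) := by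
        gcongr; exact h1.trans (by gcongr; exact hKa _)
    _ = _ := by rw [h2]; field_simp

theorem contDiff_fderiv_apply (hv : ContDiff ℝ ∞ v) (e : EuclideanSpace ℝ (Fin n)) :
    ContDiff ℝ ∞ fun y => fderiv ℝ v y e :=
  (hv.fderiv_right (m := ∞) (by simp)).clm_apply contDiff_const

theorem continuous_laplacian (hv : ContDiff ℝ ∞ v) : Continuous (laplacian v) :=
  continuous_finsetSum _ fun _ _ =>
    (contDiff_fderiv_apply (contDiff_fderiv_apply hv _) _).continuous

theorem hasCompactSupport_fderiv_of_sub_const (hc : HasCompactSupport fun x => v x - c) :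
    HasCompactSupport (fderiv ℝ v) := by
  have := hc.fderiv ℝ
  rwa [show fderiv ℝ (fun x => v x - c) = fderiv ℝ v from funext fun x => fderiv_sub_const c] at this

theorem exists_bound_of_sub_const (hv : Continuous v) (hc : HasCompactSupport fun x => v x - c) :
    ∃ B, ∀ x, |v x| ≤ B := by
  obtain ⟨B, hB⟩ := hc.exists_bound_of_continuous (hv.sub continuous_const)
  refine ⟨B + |c|, fun x => ?_⟩
  have h1 : |v x - c| ≤ B := hB x
  calc |v x| = |(v x - c) + c| := by ring_nf
    _ ≤ _ := (abs_add_le _ _).trans (by gcongr)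

theorem hasCompactSupport_fderiv_apply (hc : HasCompactSupport (fderiv ℝ v))
    (e : EuclideanSpace ℝ (Fin n)) : HasCompactSupport fun y => fderiv ℝ v y e :=
  hc.comp_left (g := fun L : EuclideanSpace ℝ (Fin n) →L[ℝ] ℝ => L e) (by simp)

theorem hasCompactSupport_laplacian (hc : HasCompactSupport fun x => v x - c) :
    HasCompactSupport (laplacian v) := by
  have h1 : ∀ i : Fin n, HasCompactSupport fun x =>
      fderiv ℝ (fun y => fderiv ℝ v y (EuclideanSpace.single i 1)) x
        (EuclideanSpace.single i 1) := fun i =>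
    (hasCompactSupport_fderiv_apply (hasCompactSupport_fderiv_of_sub_const hc) _).fderiv_apply ℝ _
  have : ∀ s : Finset (Fin n), HasCompactSupport fun x => ∑ i ∈ s,
      fderiv ℝ (fun y => fderiv ℝ v y (EuclideanSpace.single i 1)) x
        (EuclideanSpace.single i 1) := by
    intro s
    induction s using Finset.induction_on with
    | empty => simp only [Finset.sum_empty]; exact HasCompactSupport.zero
    | insert a s ha ih => simp only [Finset.sum_insert ha]; exact (h1 a).add ih
  exact this _

/-- Gaussian integration by parts: the Gaussian averages solve a heat equation in the width. -/
theorem hasDerivAt_gaussAvg (hv : ContDiff ℝ ∞ v) (hc : HasCompactSupport fun x => v x - c)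
    (x : EuclideanSpace ℝ (Fin n)) (r : ℝ) :
    HasDerivAt (fun r => gaussAvg r v x) (r * gaussAvg r (laplacian v) x) r := by
  have hg := continuous_gauss (n := n)
  have hvc : Continuous v := hv.continuous
  have hdv : Continuous (fderiv ℝ v) := hv.continuous_fderiv (by simp)
  have hds := hasCompactSupport_fderiv_of_sub_const hc
  obtain ⟨B, hB⟩ := exists_bound_of_sub_const hvc hc
  obtain ⟨L, hL⟩ := hds.exists_bound_of_continuous hdv
  have h1 := (hasDerivAt_integral_of_dominated_loc_of_deriv_le (μ := volume) (s := univ) (x₀ := r)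
    (F := fun r z => gauss z * v (x + r • z))
    (F' := fun r z => gauss z * fderiv ℝ v (x + r • z) z)
    (bound := fun z => L * (‖z‖ * gauss z)) univ_mem
    (Eventually.of_forall fun r => by fun_prop)
    (integrable_mul_comp_of_bounded integrable_gauss hvc hB x r)
    (by fun_prop)
    (ae_of_all _ fun z r _ => by
      rw [norm_mul, Real.norm_of_nonneg (gauss_nonneg z)]
      have := ((fderiv ℝ v (x + r • z)).le_opNorm z).trans
        (mul_le_mul_of_nonneg_right (hL _) (norm_nonneg z))
      have := mul_le_mul_of_nonneg_left this (gauss_nonneg z)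
      linarith)
    (integrable_norm_mul_gauss.const_mul L)
    (ae_of_all _ fun z r _ => by
      have h2 : HasDerivAt (fun r : ℝ => x + r • z) z r := by
        simpa using ((hasDerivAt_id r).smul_const z).const_add x
      have h3 := ((hv.differentiable (by simp)) (x + r • z)).hasFDerivAt.comp_hasDerivAt r h2
      exact h3.const_mul _)).2
  refine HasDerivAt.congr_deriv (f := fun r => gaussAvg r v x) h1 ?_
  have hdi : ∀ i : Fin n, ContDiff ℝ ∞ fun y => fderiv ℝ v y (EuclideanSpace.single i 1) :=
    fun i => contDiff_fderiv_apply hv _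
  have hdc : ∀ i : Fin n, HasCompactSupport fun y => fderiv ℝ v y (EuclideanSpace.single i 1) :=
    fun i => hasCompactSupport_fderiv_apply hds _
  have hdb : ∀ i : Fin n, ∃ B, ∀ y, |fderiv ℝ v y (EuclideanSpace.single i 1)| ≤ B :=
    fun i => (hdc i).exists_bound_of_continuous (hdi i).continuous
  have hddc : ∀ i : Fin n, Continuous fun y => fderiv ℝ
      (fun y => fderiv ℝ v y (EuclideanSpace.single i 1)) y (EuclideanSpace.single i 1) :=
    fun i => (contDiff_fderiv_apply (hdi i) _).continuous
  have hddb : ∀ i : Fin n, ∃ B, ∀ y, |fderiv ℝ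
      (fun y => fderiv ℝ v y (EuclideanSpace.single i 1)) y (EuclideanSpace.single i 1)| ≤ B :=
    fun i => ((hdc i).fderiv_apply ℝ _).exists_bound_of_continuous (hddc i)
  have hzg : ∀ i : Fin n, Integrable fun z : EuclideanSpace ℝ (Fin n) => gauss z * z i := by
    intro i
    refine integrable_norm_mul_gauss.mono' (by fun_prop) (ae_of_all _ fun z => ?_)
    rw [norm_mul, Real.norm_of_nonneg (gauss_nonneg z), mul_comm]
    exact mul_le_mul_of_nonneg_right (PiLp.norm_apply_le z i) (gauss_nonneg z)
  have hig : ∀ (i : Fin n), Integrable fun z : EuclideanSpace ℝ (Fin n) => gauss z * z i *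
      fderiv ℝ v (x + r • z) (EuclideanSpace.single i 1) := fun i =>
    integrable_mul_comp_of_bounded (hzg i) (hdi i).continuous (hdb i).choose_spec x r
  have hig2 : ∀ (i : Fin n), Integrable fun z : EuclideanSpace ℝ (Fin n) => gauss z *
      fderiv ℝ (fun y => fderiv ℝ v y (EuclideanSpace.single i 1)) (x + r • z)
        (EuclideanSpace.single i 1) := fun i =>
    integrable_mul_comp_of_bounded integrable_gauss (hddc i) (hddb i).choose_spec x r
  -- Since `z i * gauss z = -∂ᵢ gauss z`, integration by parts trades the factor `z i` from the
  -- radial derivative for a second derivative of `v` and a factor `r`.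
  have hk : ∀ i : Fin n, ∫ z, gauss z * z i *
      fderiv ℝ v (x + r • z) (EuclideanSpace.single i 1) =
      r * ∫ z, gauss z * fderiv ℝ (fun y => fderiv ℝ v y (EuclideanSpace.single i 1)) (x + r • z)
        (EuclideanSpace.single i 1) := by
    intro i
    set e : EuclideanSpace ℝ (Fin n) := EuclideanSpace.single i 1 with he
    have hgd : ∀ z : EuclideanSpace ℝ (Fin n), fderiv ℝ gauss z e = -(gauss z * z i) := by
      intro z
      rw [(hasFDerivAt_gauss z).fderiv]
      simp [he, EuclideanSpace.inner_single_right]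
    have hcd : ∀ z : EuclideanSpace ℝ (Fin n), HasFDerivAt (fun z => fderiv ℝ v (x + r • z) e)
        ((fderiv ℝ (fun y => fderiv ℝ v y e) (x + r • z)).comp
          (r • ContinuousLinearMap.id ℝ (EuclideanSpace ℝ (Fin n)))) z := by
      intro z
      have h2 : HasFDerivAt (fun z : EuclideanSpace ℝ (Fin n) => x + r • z)
          (r • ContinuousLinearMap.id ℝ (EuclideanSpace ℝ (Fin n))) z :=
        ((hasFDerivAt_id z).const_smul r).const_add x
      exact (((hdi i).differentiable (by simp)) (x + r • z)).hasFDerivAt.comp z h2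
    have hcd' : ∀ z : EuclideanSpace ℝ (Fin n), fderiv ℝ (fun z => fderiv ℝ v (x + r • z) e) z e =
        r * fderiv ℝ (fun y => fderiv ℝ v y e) (x + r • z) e := by
      intro z
      rw [(hcd z).fderiv]
      simp
    have hibp := integral_mul_fderiv_eq_neg_fderiv_mul_of_integrable
      (μ := (volume : Measure (EuclideanSpace ℝ (Fin n))))
      (f := gauss) (g := fun z => fderiv ℝ v (x + r • z) e) (v := e)
      (by simp only [hgd, neg_mul]; exact (hig i).neg)
      (by
        simp only [hcd']
        exact ((hig2 i).const_mul r).congr (ae_of_all _ fun z => by ring))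
      (integrable_mul_comp_of_bounded integrable_gauss (hdi i).continuous
        (hdb i).choose_spec x r)
      (fun z _ => (hasFDerivAt_gauss z).differentiableAt)
      (fun z _ => (hcd z).differentiableAt)
    simp only [hgd, hcd', neg_mul, integral_neg, neg_neg] at hibp
    rw [← hibp, ← integral_const_mul]
    congr 1; ext z; ring
  have hsum : ∀ z : EuclideanSpace ℝ (Fin n), gauss z * fderiv ℝ v (x + r • z) z =
      ∑ i, gauss z * z i * fderiv ℝ v (x + r • z) (EuclideanSpace.single i 1) := by
    intro z
    have hz : z = ∑ i, z i • EuclideanSpace.single i (1 : ℝ) := by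
      simpa using ((EuclideanSpace.basisFun (Fin n) ℝ).sum_repr z).symm
    conv_lhs => enter [2, 2]; rw [hz]
    simp only [map_sum, map_smul, smul_eq_mul, Finset.mul_sum, mul_assoc]
  simp_rw [hsum]
  rw [integral_finsetSum _ fun i _ => hig i, gaussAvg]
  simp only [laplacian, Finset.mul_sum]
  rw [integral_finsetSum _ fun i _ => hig2 i, Finset.mul_sum]
  exact Finset.sum_congr rfl fun i _ => hk i

end GaussAvg

/-! ### A priori estimates for smooth functions at unit scale -/

section SmoothEstimates

variable {n : ℕ} {v : EuclideanSpace ℝ (Fin n) → ℝ} {c : ℝ}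

theorem gaussAvg_sub_eq_integral (hv : ContDiff ℝ ∞ v) (hc : HasCompactSupport fun x => v x - c)
    (x : EuclideanSpace ℝ (Fin n)) (a b : ℝ) :
    ∫ r in a..b, r * gaussAvg r (laplacian v) x = gaussAvg b v x - gaussAvg a v x := by
  obtain ⟨B, hB⟩ := (hasCompactSupport_laplacian hc).exists_bound_of_continuous
    (continuous_laplacian hv)
  exact intervalIntegral.integral_eq_sub_of_hasDerivAt
    (fun r _ => hasDerivAt_gaussAvg hv hc x r)
    ((continuous_id.mul (continuous_gaussAvg (continuous_laplacian hv) hB x)).intervalIntegrable _ _)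

theorem integral_rpow_neg_half {d : ℝ} : ∫ r in (0 : ℝ)..d, r ^ (-(1 / 2) : ℝ) = 2 * √d := by
  rw [integral_rpow (Or.inl (by norm_num)), Real.sqrt_eq_rpow]
  norm_num
  ring

theorem intervalIntegrable_rpow_neg_half {a b : ℝ} :
    IntervalIntegrable (fun r : ℝ => r ^ (-(1 / 2) : ℝ)) volume a b :=
  intervalIntegral.intervalIntegrable_rpow' (by norm_num)

/-- Sobolev bound: in dimension at most three a function is controlled by its `L²` norm and that
of its Laplacian. -/
theorem exists_abs_le_of_laplacian (n : ℕ) (hn : n ≤ 3) : ∃ K : ℝ, 0 ≤ K ∧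
    ∀ v : EuclideanSpace ℝ (Fin n) → ℝ, ContDiff ℝ ∞ v → HasCompactSupport v →
    ∀ N₁ N₂ : ℝ, 0 ≤ N₁ → 0 ≤ N₂ → ∫ z, v z ^ 2 ≤ N₁ ^ 2 → ∫ z, laplacian v z ^ 2 ≤ N₂ ^ 2 →
    ∀ x, |v x| ≤ K * (N₁ + N₂) := by
  obtain ⟨K, hK, hKa⟩ := exists_mul_abs_gaussAvg_le n hn
  refine ⟨2 * K, by positivity, fun v hv hvc N₁ N₂ hN₁ hN₂ h1 h2 x => ?_⟩
  have hc : HasCompactSupport fun x => v x - 0 := by simpa using hvc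
  have hD := gaussAvg_sub_eq_integral hv hc x 0 1
  rw [gaussAvg_zero] at hD
  have h3 := hKa v hv.continuous hvc N₁ hN₁ h1 1 one_pos le_rfl x
  rw [one_mul, Real.one_rpow, mul_one] at h3
  have h4 : |∫ r in (0 : ℝ)..1, r * gaussAvg r (laplacian v) x| ≤
      ∫ r in (0 : ℝ)..1, K * N₂ * r ^ (-(1 / 2) : ℝ) := by
    refine intervalIntegral.norm_integral_le_of_norm_le
      (f := fun r => r * gaussAvg r (laplacian v) x) zero_le_one (ae_of_all _ fun r hr => ?_) (intervalIntegrable_rpow_neg_half.const_mul _)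
    rw [norm_mul, Real.norm_of_nonneg hr.1.le]
    exact hKa _ (continuous_laplacian hv) (hasCompactSupport_laplacian hc) N₂ hN₂ h2 r hr.1 hr.2 x
  rw [intervalIntegral.integral_const_mul, integral_rpow_neg_half, Real.sqrt_one] at h4
  rw [abs_le] at h3 h4 ⊢
  have : 0 ≤ K * N₁ := by positivity
  constructor <;> linarith [h3.1, h3.2, h4.1, h4.2]

/-- Hölder estimate for smooth functions whose Laplacian is the sum of a bounded and a square
integrable function. -/
theorem exists_holder_of_laplacian (n : ℕ) (hn : n ≤ 3) : ∃ K : ℝ, 0 ≤ K ∧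
    ∀ (v h₁ h₂ : EuclideanSpace ℝ (Fin n) → ℝ) (c M M₁ N : ℝ), ContDiff ℝ ∞ v →
    HasCompactSupport (fun x => v x - c) → (∀ x, |v x| ≤ M) →
    (∀ x, laplacian v x = h₁ x + h₂ x) → Continuous h₁ → (∀ x, |h₁ x| ≤ M₁) →
    Continuous h₂ → HasCompactSupport h₂ → 0 ≤ N → ∫ z, h₂ z ^ 2 ≤ N ^ 2 →
    ∀ x y, dist x y ≤ 1 → |v x - v y| ≤ K * (M + M₁ + N) * √(dist x y) := by
  obtain ⟨K₁, hK₁, hKa₁⟩ := exists_abs_gaussAvg_sub_le n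
  obtain ⟨K₂, hK₂, hKa₂⟩ := exists_mul_abs_gaussAvg_le n hn
  obtain ⟨K₃, hK₃, hKa₃⟩ := exists_mul_abs_gaussAvg_sub_le n hn
  refine ⟨K₁ + 4 * K₂ + 2 * K₃, by positivity,
    fun v h₁ h₂ c M M₁ N hv hc hM hlap hh₁ hM₁ hh₂ hhc₂ hN hhN x y hxy => ?_⟩
  have hM0 : 0 ≤ M := (abs_nonneg _).trans (hM 0)
  have hM10 : 0 ≤ M₁ := (abs_nonneg _).trans (hM₁ 0)
  set d := dist x y with hd
  rcases (dist_nonneg (x := x) (y := y)).eq_or_lt with h0 | h0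
  · rw [dist_eq_zero.1 h0.symm, sub_self, abs_zero]; positivity
  rw [← hd] at h0
  have hds : d ≤ √d := Real.le_sqrt_of_sq_le (by nlinarith)
  obtain ⟨B, hB⟩ := hhc₂.exists_bound_of_continuous hh₂
  obtain ⟨B', hB'⟩ := (hasCompactSupport_laplacian hc).exists_bound_of_continuous
    (continuous_laplacian hv)
  have hcl := continuous_laplacian hv
  have hcont : Continuous fun r =>
      r * (gaussAvg r (laplacian v) x - gaussAvg r (laplacian v) y) :=
    continuous_id.mul ((continuous_gaussAvg hcl hB' x).sub (continuous_gaussAvg hcl hB' y))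
  set D := fun r => r * (gaussAvg r (laplacian v) x - gaussAvg r (laplacian v) y) with hD
  have hdec : ∀ r x, gaussAvg r (laplacian v) x = gaussAvg r h₁ x + gaussAvg r h₂ x := by
    intro r x
    rw [← gaussAvg_add hh₁ hM₁ hh₂ hB]
    congr 1; ext z; exact hlap z
  have hDi : ∀ a b, ∫ r in a..b, D r =
      (gaussAvg b v x - gaussAvg a v x) - (gaussAvg b v y - gaussAvg a v y) := by
    intro a b
    rw [← gaussAvg_sub_eq_integral hv hc, ← gaussAvg_sub_eq_integral hv hc,
      ← intervalIntegral.integral_sub]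
    · simp only [hD, mul_sub]
    · exact (continuous_id.mul (continuous_gaussAvg hcl hB' x)).intervalIntegrable _ _
    · exact (continuous_id.mul (continuous_gaussAvg hcl hB' y)).intervalIntegrable _ _
  have hb1 : ∀ r, 0 < r → |D r| ≤ K₁ * M₁ * d + r * |gaussAvg r h₂ x - gaussAvg r h₂ y| := by
    intro r hr
    have e1 : D r = r * (gaussAvg r h₁ x - gaussAvg r h₁ y) +
        r * (gaussAvg r h₂ x - gaussAvg r h₂ y) := by
      simp only [hD, hdec]; ring
    rw [e1]
    refine (abs_add_le _ _).trans ?_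
    rw [abs_mul, abs_mul, abs_of_pos hr]
    exact add_le_add (hKa₁ h₁ hh₁ M₁ hM₁ r hr x y) le_rfl
  -- For widths below `d` the two averages of `h₂` are bounded separately, and `∫₀ᵈ r^(-1/2)` gives
  -- `√d`.
  have hsmall : |∫ r in (0 : ℝ)..d, D r| ≤ K₁ * M₁ * d * d + 2 * K₂ * N * (2 * √d) := by
    have : |∫ r in (0 : ℝ)..d, D r| ≤
        ∫ r in (0 : ℝ)..d, (K₁ * M₁ * d + 2 * K₂ * N * r ^ (-(1 / 2) : ℝ)) := by
      refine intervalIntegral.norm_integral_le_of_norm_le (f := D) h0.le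
        (ae_of_all _ fun r hr => (hb1 r hr.1).trans ?_)
        (intervalIntegrable_const.add (intervalIntegrable_rpow_neg_half.const_mul _))
      have hr1 : r ≤ 1 := hr.2.trans hxy
      have a1 := hKa₂ h₂ hh₂ hhc₂ N hN hhN r hr.1 hr1 x
      have a2 := hKa₂ h₂ hh₂ hhc₂ N hN hhN r hr.1 hr1 y
      have a3 := mul_le_mul_of_nonneg_left (abs_sub (gaussAvg r h₂ x) (gaussAvg r h₂ y)) hr.1.le
      linarith
    rw [intervalIntegral.integral_add intervalIntegrable_const
      (intervalIntegrable_rpow_neg_half.const_mul _), intervalIntegral.integral_const,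
      intervalIntegral.integral_const_mul,
      integral_rpow_neg_half] at this
    simp only [sub_zero, smul_eq_mul] at this
    linarith
  -- For widths above `d` cancellation between the kernels is used; `d ∫ r^(-3/2)` over `(d, 1)`
  -- again gives `√d`.
  have hlarge : |∫ r in d..1, D r| ≤ K₁ * M₁ * d * (1 - d) + K₃ * N * (2 * √d) := by
    have hint : IntervalIntegrable (fun r : ℝ => r ^ (-(3 / 2) : ℝ)) volume d 1 :=
      intervalIntegral.intervalIntegrable_rpow
        (Or.inr (by rw [uIcc_of_le hxy]; exact fun h => h0.not_ge h.1))
    have : |∫ r in d..1, D r| ≤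
        ∫ r in d..1, (K₁ * M₁ * d + K₃ * N * d * r ^ (-(3 / 2) : ℝ)) := by
      refine intervalIntegral.norm_integral_le_of_norm_le (f := D) hxy
        (ae_of_all _ fun r hr => (hb1 r (h0.trans hr.1)).trans ?_)
        (intervalIntegrable_const.add (hint.const_mul _))
      have := hKa₃ h₂ hh₂ hhc₂ N hN hhN r (h0.trans hr.1) hr.2 x y
      linarith
    rw [intervalIntegral.integral_add intervalIntegrable_const
      (hint.const_mul _), intervalIntegral.integral_const,
      intervalIntegral.integral_const_mul, integral_rpow
        (Or.inr ⟨by norm_num, by rw [uIcc_of_le hxy]; exact fun h => h0.not_ge h.1⟩)] at this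
    simp only [smul_eq_mul] at this
    have e1 : d * ((1 ^ (-(3 / 2) + 1 : ℝ) - d ^ (-(3 / 2) + 1 : ℝ)) / (-(3 / 2) + 1 : ℝ)) ≤
        2 * √d := by
      have e2 : d * d ^ (-(3 / 2) + 1 : ℝ) = √d := by
        nth_rewrite 1 [← Real.rpow_one d]
        rw [← Real.rpow_add h0, Real.sqrt_eq_rpow]; norm_num
      rw [Real.one_rpow]
      have e3 : d * ((1 - d ^ (-(3 / 2) + 1 : ℝ)) / (-(3 / 2) + 1 : ℝ)) =
          2 * (d * d ^ (-(3 / 2) + 1 : ℝ)) - 2 * d := by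
        ring
      rw [e3, e2]; linarith
    have e4 := mul_le_mul_of_nonneg_left e1 (mul_nonneg hK₃ hN)
    linarith
  have hone := hKa₁ v hv.continuous M hM 1 one_pos x y
  rw [one_mul, ← hd] at hone
  have hsplit := hDi 0 1
  rw [← intervalIntegral.integral_add_adjacent_intervals (hcont.intervalIntegrable 0 d)
    (hcont.intervalIntegrable d 1), gaussAvg_zero, gaussAvg_zero] at hsplit
  have htot : |v x - v y| ≤ K₁ * M * d + (K₁ * M₁ * d * d + 2 * K₂ * N * (2 * √d)) +
      (K₁ * M₁ * d * (1 - d) + K₃ * N * (2 * √d)) := by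
    rw [abs_le] at *
    constructor <;> linarith [hone.1, hone.2, hsmall.1, hsmall.2, hlarge.1, hlarge.2]
  refine htot.trans ?_
  have t1 : K₁ * (M + M₁) * d ≤ K₁ * (M + M₁) * √d := by gcongr
  have t2 : 0 ≤ √d := Real.sqrt_nonneg d
  have t3 : 0 ≤ K₁ * N * √d := by positivity
  have t4 : 0 ≤ (4 * K₂ + 2 * K₃) * (M + M₁) * √d := by positivity
  linarith

/-- A smooth form of Kato's inequality: `s ↦ √(1 + s²)` is convex, so the term with its second
derivative and `|∇v|²` is nonnegative and is dropped. -/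
theorem sqrt_one_add_sq_sub_laplacian_le (hv : ContDiff ℝ ∞ v) (x : EuclideanSpace ℝ (Fin n)) :
    v x / √(1 + v x ^ 2) * laplacian v x ≤ laplacian (fun y => √(1 + v y ^ 2)) x := by
  have hpos : ∀ y, 0 < 1 + v y ^ 2 := fun y => by positivity
  have hd : ∀ y, HasFDerivAt v (fderiv ℝ v y) y := fun y =>
    ((hv.differentiable (by simp)) y).hasFDerivAt
  have hw : ∀ y, HasFDerivAt (fun y => √(1 + v y ^ 2))
      ((v y / √(1 + v y ^ 2)) • fderiv ℝ v y) y := by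
    intro y
    have h1 := (((hd y).pow 2).const_add 1).sqrt (hpos y).ne'
    refine h1.congr_fderiv ?_
    ext e
    simp
    field_simp
  have hq : ∀ y, HasFDerivAt (fun y => v y / √(1 + v y ^ 2))
      ((1 / √(1 + v y ^ 2) ^ 3) • fderiv ℝ v y) y := by
    intro y
    have hs : √(1 + v y ^ 2) ≠ 0 := (Real.sqrt_pos.2 (hpos y)).ne'
    have h2 := Real.sq_sqrt (hpos y).le
    have h1 : HasDerivAt (fun s : ℝ => s / √(1 + s ^ 2)) (1 / √(1 + v y ^ 2) ^ 3) (v y) := by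
      have h3 := (hasDerivAt_id (v y)).fun_div
        ((((hasDerivAt_id (v y)).fun_pow 2).const_add 1).sqrt (hpos y).ne') hs
      refine h3.congr_deriv ?_
      simp only [id]
      field_simp
      rw [h2]; norm_num; ring
    exact h1.comp_hasFDerivAt y (hd y)
  have hdd : ∀ e, HasFDerivAt (fun y => fderiv ℝ v y e)
      (fderiv ℝ (fun y => fderiv ℝ v y e) x) x := fun e =>
    (((contDiff_fderiv_apply hv e).differentiable (by simp)) x).hasFDerivAt
  simp only [laplacian, Finset.mul_sum]
  refine Finset.sum_le_sum fun i _ => ?_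
  set e : EuclideanSpace ℝ (Fin n) := EuclideanSpace.single i 1
  have h3 : (fun y => fderiv ℝ (fun y => √(1 + v y ^ 2)) y e) =
      fun y => v y / √(1 + v y ^ 2) * fderiv ℝ v y e := by
    ext y; rw [(hw y).fderiv]; rfl
  rw [h3, ((hq x).fun_mul (hdd e)).fderiv]
  simp only [add_apply, smul_apply, smul_eq_mul]
  have h4 : 0 ≤ fderiv ℝ v x e * (1 / √(1 + v x ^ 2) ^ 3 * fderiv ℝ v x e) := by
    have : 0 ≤ 1 / √(1 + v x ^ 2) ^ 3 := by positivity
    nlinarith [mul_nonneg this (mul_self_nonneg (fderiv ℝ v x e))]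
  linarith

/-- Uniform bound for smooth approximate solutions of `Δv = v³ - v + f` with `f ∈ L²`. -/
theorem exists_abs_le_of_laplacian_eq_cubic (n : ℕ) (hn : n ≤ 3) : ∃ K : ℝ, 0 ≤ K ∧
    ∀ (v f : EuclideanSpace ℝ (Fin n) → ℝ) (c η N : ℝ), ContDiff ℝ ∞ v →
    HasCompactSupport (fun x => v x - c) →
    (∀ x, |laplacian v x - (v x ^ 3 - v x) - f x| ≤ η) →
    Continuous f → HasCompactSupport f → 0 ≤ N → ∫ z, f z ^ 2 ≤ N ^ 2 →
    ∀ x, |v x| ≤ K * (2 + η + N) := by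
  obtain ⟨K, hK, hKa⟩ := exists_mul_abs_gaussAvg_le n hn
  refine ⟨3 + 6 * K, by positivity, fun v f c η N hv hc hlap hf hfc hN hfN x => ?_⟩
  have hη : 0 ≤ η := (abs_nonneg _).trans (hlap 0)
  set w : EuclideanSpace ℝ (Fin n) → ℝ := fun y => √(1 + v y ^ 2) with hw
  have hws : ContDiff ℝ ∞ w := ContDiff.sqrt (by fun_prop) fun y => by positivity
  have hwc : HasCompactSupport fun x => w x - √(1 + c ^ 2) := by
    have := hc.comp_left (g := fun t => √(1 + (t + c) ^ 2) - √(1 + c ^ 2)) (by simp)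
    simpa [Function.comp_def, hw] using this
  obtain ⟨B, hB⟩ := exists_bound_of_sub_const hws.continuous hwc
  obtain ⟨B', hB'⟩ := (hasCompactSupport_laplacian hwc).exists_bound_of_continuous
    (continuous_laplacian hws)
  obtain ⟨Bf, hBf⟩ := hfc.exists_bound_of_continuous hf
  have hcw := hws.continuous
  have hclw := continuous_laplacian hws
  have hpt : ∀ y, w y ≤ laplacian w y + ((2 + η) + |f y|) := by
    intro y
    have h1 := sqrt_one_add_sq_sub_laplacian_le hv y
    have hw1 : 1 ≤ w y := Real.one_le_sqrt.2 (by nlinarith [sq_nonneg (v y)])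
    have hw2 : w y ^ 2 = 1 + v y ^ 2 := Real.sq_sqrt (by positivity)
    have hvw : |v y / w y| ≤ 1 := by
      rw [abs_div, abs_of_pos (by linarith : 0 < w y), div_le_one (by linarith)]
      exact abs_le_of_sq_le_sq (by nlinarith) (by linarith)
    change v y / w y * laplacian v y ≤ laplacian w y at h1
    -- Multiplied by `w`, the left side is `1 + 2v² - v⁴ = 2 - (v² - 1)²`, which is at most `2 ≤
    -- 2w`. This is where the sign of the cubic is used.
    have h2 : w y - v y / w y * (v y ^ 3 - v y) ≤ 2 := by
      have h3 : w y - v y / w y * (v y ^ 3 - v y) = (w y ^ 2 - v y * (v y ^ 3 - v y)) / w y := by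
        field_simp
      rw [h3, div_le_iff₀ (by linarith), hw2]
      nlinarith [sq_nonneg (v y ^ 2 - 1)]
    have h4 : |v y / w y * (laplacian v y - (v y ^ 3 - v y))| ≤ η + |f y| := by
      rw [abs_mul]
      have h5 : |laplacian v y - (v y ^ 3 - v y)| ≤ η + |f y| := by
        have := abs_sub_abs_le_abs_sub (laplacian v y - (v y ^ 3 - v y)) (f y)
        linarith [hlap y]
      calc _ ≤ 1 * (η + |f y|) := by gcongr
        _ = _ := one_mul _
    have h6 := (abs_le.1 h4).1
    have h7 : v y / w y * (laplacian v y - (v y ^ 3 - v y)) =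
      v y / w y * laplacian v y - v y / w y * (v y ^ 3 - v y) := by ring
    linarith
  have havg : ∀ r y, gaussAvg r w y ≤
      gaussAvg r (laplacian w) y + ((2 + η) + gaussAvg r (fun z => |f z|) y) := by
    intro r y
    have b1 : ∀ y, abs (2 + η + |f y|) ≤ 2 + η + Bf := fun y => by
      rw [abs_of_nonneg (by positivity)]
      have : |f y| ≤ Bf := hBf y
      linarith
    have b2 : ∀ y, abs (laplacian w y + ((2 + η) + |f y|)) ≤ B' + (2 + η + Bf) := fun y =>
      (abs_add_le _ _).trans (add_le_add (hB' y) (b1 y))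
    have c1 : Continuous fun y => (2 + η) + |f y| := continuous_const.add hf.abs
    have c2 : Continuous fun y => laplacian w y + ((2 + η) + |f y|) := hclw.add c1
    refine (gaussAvg_mono hcw hB c2 b2 hpt r y).trans ?_
    rw [gaussAvg_add hclw hB' c1 b1,
      gaussAvg_add (B := |2 + η|) (B' := Bf) continuous_const (fun _ => le_rfl) hf.abs
        (fun y => by rw [abs_abs]; exact hBf y), gaussAvg_const]
  -- The damping factor turns `Δ` into `Δ - 1` in the heat equation, and `w - Δw` is exactly what
  -- `havg` controls.
  have hderiv : ∀ y r, HasDerivAt (fun r => Real.exp (-(r ^ 2 / 2)) * gaussAvg r w y)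
      (-(r * Real.exp (-(r ^ 2 / 2)) * (gaussAvg r w y - gaussAvg r (laplacian w) y))) r := by
    intro y r
    have h1 : HasDerivAt (fun r : ℝ => -(r ^ 2 / 2)) (-r) r := by
      have := (((hasDerivAt_id r).pow 2).div_const 2).neg
      refine this.congr_deriv ?_
      simp
    refine (h1.exp.mul (hasDerivAt_gaussAvg hws hwc y r)).congr_deriv ?_
    ring
  set R := (2 + η) + 2 * (K * N) with hR
  have hmain : ∀ y, w y ≤ Real.exp (-(1 / 2)) * (⨆ z, w z) + R := by
    intro y
    have hbdd : BddAbove (range w) := ⟨B, by rintro _ ⟨z, rfl⟩; exact (abs_le.1 (hB z)).2⟩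
    have hcd : Continuous fun r => r * Real.exp (-(r ^ 2 / 2)) *
        (gaussAvg r w y - gaussAvg r (laplacian w) y) := by
      have := continuous_gaussAvg hcw hB y
      have := continuous_gaussAvg hclw hB' y
      fun_prop
    have hF := intervalIntegral.integral_eq_sub_of_hasDerivAt (a := 0) (b := 1)
      (fun r _ => hderiv y r) (hcd.neg.intervalIntegrable _ _)
    have hle : ∫ r in (0 : ℝ)..1, (r * Real.exp (-(r ^ 2 / 2)) *
        (gaussAvg r w y - gaussAvg r (laplacian w) y)) ≤
        ∫ r in (0 : ℝ)..1, ((2 + η) + K * N * r ^ (-(1 / 2) : ℝ)) := by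
      refine intervalIntegral.integral_mono_on_of_le_Ioo zero_le_one
        (hcd.intervalIntegrable _ _)
        (intervalIntegrable_const.add (intervalIntegrable_rpow_neg_half.const_mul _))
        fun r hr => ?_
      have e1 : Real.exp (-(r ^ 2 / 2)) ≤ 1 := Real.exp_le_one_iff.2 (by nlinarith [sq_nonneg r])
      have e2 : 0 < Real.exp (-(r ^ 2 / 2)) := Real.exp_pos _
      have e3 := hKa (fun z => |f z|) hf.abs hfc.norm N hN (by simpa using hfN) r hr.1 hr.2.le y
      have e4 : 0 ≤ gaussAvg r (fun z => |f z|) y :=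
        integral_nonneg fun z => mul_nonneg (gauss_nonneg z) (abs_nonneg _)
      rw [abs_of_nonneg e4] at e3
      have e5 := havg r y
      have hr0 := hr.1
      calc _ ≤ r * Real.exp (-(r ^ 2 / 2)) * ((2 + η) + gaussAvg r (fun z => |f z|) y) := by
            gcongr; linarith
        _ ≤ r * 1 * ((2 + η) + gaussAvg r (fun z => |f z|) y) := by gcongr
        _ = r * (2 + η) + r * gaussAvg r (fun z => |f z|) y := by ring
        _ ≤ 1 * (2 + η) + K * N * r ^ (-(1 / 2) : ℝ) := by gcongr; exact hr.2.le
        _ = _ := by ring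
    rw [intervalIntegral.integral_add intervalIntegrable_const
      (intervalIntegrable_rpow_neg_half.const_mul _), intervalIntegral.integral_const,
      intervalIntegral.integral_const_mul,
      integral_rpow_neg_half] at hle
    rw [intervalIntegral.integral_neg] at hF
    norm_num [gaussAvg_zero] at hF hle
    have h1 : gaussAvg 1 w y ≤ ⨆ z, w z := by
      have := gaussAvg_mono (h' := fun _ => ⨆ z, w z) hcw hB continuous_const
        (fun _ => le_rfl) (fun z => le_ciSup hbdd z) 1 y
      rwa [gaussAvg_const] at this
    have h2 := mul_le_mul_of_nonneg_left h1 (Real.exp_pos (-(1 / 2))).le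
    norm_num at h2 ⊢
    linarith
  have hsup : (⨆ z, w z) ≤ Real.exp (-(1 / 2)) * (⨆ z, w z) + R := ciSup_le hmain
  have hbdd : BddAbove (range w) := ⟨B, by rintro _ ⟨z, rfl⟩; exact (abs_le.1 (hB z)).2⟩
  have hw0 : w x ≤ ⨆ z, w z := le_ciSup hbdd x
  have hvw : |v x| ≤ w x := Real.abs_le_sqrt (by linarith)
  -- The supremum is finite because `w` is constant near infinity, so it can be absorbed: `S ≤ (2/3)
  -- S + R` gives `S ≤ 3 R`.
  have hexp : Real.exp (-(1 / 2)) ≤ 2 / 3 := by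
    have h1 := Real.add_one_le_exp (1 / 2 : ℝ)
    rw [Real.exp_neg, inv_le_comm₀ (Real.exp_pos _) (by norm_num)]
    linarith
  have h3 : (⨆ z, w z) ≤ 3 * R := by
    have h4 : 0 ≤ ⨆ z, w z := (abs_nonneg _).trans (hvw.trans hw0)
    nlinarith
  have t1 : 0 ≤ K * (2 + η) := by positivity
  have t2 : 3 * R = 3 * (2 + η) + 6 * (K * N) := by rw [hR]; ring
  nlinarith

end SmoothEstimates

/-! ### Mollification and weak derivatives -/

section Mollify

open scoped Convolution
open ContinuousLinearMap (lsmul)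

variable {n : ℕ} {u g : EuclideanSpace ℝ (Fin n) → ℝ} {c R : ℝ} {k : ℕ}

/-- Bump functions around `0` with radii shrinking to `0`. -/
noncomputable def bump (n k : ℕ) : ContDiffBump (0 : EuclideanSpace ℝ (Fin n)) where
  rIn := 1 / ((k : ℝ) + 1)
  rOut := 2 / ((k : ℝ) + 1)
  rIn_pos := by positivity
  rIn_lt_rOut := by gcongr; norm_num

theorem bump_rOut_le : (bump n k).rOut ≤ 2 := by
  change 2 / ((k : ℝ) + 1) ≤ 2
  rw [div_le_iff₀ (by positivity)]
  have : (0 : ℝ) ≤ k := k.cast_nonneg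
  linarith

theorem tendsto_bump_rOut : Tendsto (fun k => (bump n k).rOut) atTop (𝓝 0) := by
  have := (tendsto_one_div_add_atTop_nhds_zero_nat (𝕜 := ℝ)).const_mul 2
  rw [mul_zero] at this
  refine this.congr fun k => ?_
  change 2 * (1 / ((k : ℝ) + 1)) = 2 / ((k : ℝ) + 1)
  ring

/-- Convolution with a normalised bump function. -/
noncomputable def mollify (k : ℕ) (u : EuclideanSpace ℝ (Fin n) → ℝ) :
    EuclideanSpace ℝ (Fin n) → ℝ :=
  (bump n k).normed volume ⋆[lsmul ℝ ℝ, volume] u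

theorem mollify_apply (x : EuclideanSpace ℝ (Fin n)) :
    mollify k u x = ∫ t, (bump n k).normed volume t * u (x - t) := rfl

theorem mollify_apply_swap (x : EuclideanSpace ℝ (Fin n)) :
    mollify k u x = ∫ t, (bump n k).normed volume (x - t) * u t :=
  convolution_eq_swap _

theorem mollify_congr {u' : EuclideanSpace ℝ (Fin n) → ℝ} (h : u =ᵐ[volume] u') :
    mollify k u = mollify k u' :=
  convolution_congr _ (ae_eq_refl _) h

theorem contDiff_mollify (hu : LocallyIntegrable u) : ContDiff ℝ ∞ (mollify k u) :=
  (bump n k).hasCompactSupport_normed.contDiff_convolution_left _ (bump n k).contDiff_normed hu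

theorem integrable_bump_mul (hu : LocallyIntegrable u) (x : EuclideanSpace ℝ (Fin n)) :
    Integrable fun t => (bump n k).normed volume t * u (x - t) :=
  ((bump n k).hasCompactSupport_normed.convolutionExists_left (lsmul ℝ ℝ)
    (bump n k).continuous_normed hu x).integrable

theorem mollify_add (hu : LocallyIntegrable u) (hg : LocallyIntegrable g)
    (x : EuclideanSpace ℝ (Fin n)) :
    mollify k (fun y => u y + g y) x = mollify k u x + mollify k g x := by
  simp only [mollify_apply, mul_add]
  exact integral_add (integrable_bump_mul hu x) (integrable_bump_mul hg x)

theorem mollify_const (x : EuclideanSpace ℝ (Fin n)) :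
    mollify k (fun _ => c) x = c := by
  simp [mollify_apply, integral_mul_const, (bump n k).integral_normed]

theorem mollify_sub_const (hu : LocallyIntegrable u) (x : EuclideanSpace ℝ (Fin n)) :
    mollify k (fun y => u y - c) x = mollify k u x - c := by
  simp only [sub_eq_add_neg]
  rw [mollify_add hu (locallyIntegrable_const _), mollify_const]

theorem mollify_sum {ι : Type*} (s : Finset ι) {h : ι → EuclideanSpace ℝ (Fin n) → ℝ}
    (hh : ∀ i, LocallyIntegrable (h i)) (x : EuclideanSpace ℝ (Fin n)) :
    mollify k (fun y => ∑ i ∈ s, h i y) x = ∑ i ∈ s, mollify k (h i) x := by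
  simp only [mollify_apply, Finset.mul_sum]
  exact integral_finsetSum _ fun i _ => integrable_bump_mul (hh i) x

theorem abs_mollify_le {B : ℝ} (hB : ∀ x, |u x| ≤ B) (x : EuclideanSpace ℝ (Fin n)) :
    |mollify k u x| ≤ B := by
  have h1 : |mollify k u x| ≤ ∫ t, (bump n k).normed volume t * B := by
    refine norm_integral_le_of_norm_le (f := fun t => (bump n k).normed volume t * u (x - t))
      ((bump n k).integrable_normed.mul_const B) (ae_of_all _ fun t => ?_)
    rw [norm_mul, Real.norm_of_nonneg ((bump n k).nonneg_normed t)]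
    exact mul_le_mul_of_nonneg_left (hB _) ((bump n k).nonneg_normed t)
  rwa [integral_mul_const, (bump n k).integral_normed, one_mul] at h1

/-- Mollification commutes with weak differentiation. -/
theorem fderiv_mollify {i : Fin n} (h : HasWeakPartialDeriv i u g)
    (x : EuclideanSpace ℝ (Fin n)) :
    fderiv ℝ (mollify k u) x (EuclideanSpace.single i 1) = mollify k g x := by
  obtain ⟨hu, hg, hw⟩ := h
  set ρ := (bump n k).normed (volume : Measure (EuclideanSpace ℝ (Fin n))) with hρ
  set e : EuclideanSpace ℝ (Fin n) := EuclideanSpace.single i 1 with he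
  have hρd : ContDiff ℝ ∞ ρ := (bump n k).contDiff_normed
  have hρc : HasCompactSupport ρ := (bump n k).hasCompactSupport_normed
  have hd := (hρc.hasFDerivAt_convolution_left (lsmul ℝ ℝ) (hρd.of_le (by simp)) hu x).fderiv
  have hex : Integrable (fun t => ContinuousLinearMap.precompL (EuclideanSpace ℝ (Fin n))
      (lsmul ℝ ℝ : ℝ →L[ℝ] ℝ →L[ℝ] ℝ) (fderiv ℝ ρ t) (u (x - t))) :=
    ((hρc.fderiv ℝ).convolutionExists_left _ (hρd.continuous_fderiv (by simp)) hu x).integrable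
  have h1 : fderiv ℝ (mollify k u) x e = ∫ t, fderiv ℝ ρ t e * u (x - t) := by
    rw [mollify, hd, convolution_def, ContinuousLinearMap.integral_apply hex]
    rfl
  -- The reflected kernel serves as the test function in the definition of the weak derivative.
  set φ : EuclideanSpace ℝ (Fin n) → ℝ := fun y => ρ (x - y) with hφ
  have hφd : ContDiff ℝ ∞ φ := hρd.comp (contDiff_const.sub contDiff_id)
  have hφc : HasCompactSupport φ := hρc.comp_homeomorph (Homeomorph.subLeft x)
  have hφ' : ∀ y, fderiv ℝ φ y e = -(fderiv ℝ ρ (x - y) e) := by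
    intro y
    have h2 : HasFDerivAt (fun y : EuclideanSpace ℝ (Fin n) => x - y)
        (-ContinuousLinearMap.id ℝ (EuclideanSpace ℝ (Fin n))) y :=
      (hasFDerivAt_id y).const_sub x
    have h3 := ((hρd.differentiable (by simp)) (x - y)).hasFDerivAt.comp y h2
    have h4 : fderiv ℝ φ y = _ := h3.fderiv
    rw [h4]; simp
  have h5 := hw φ hφd hφc
  rw [mollify_apply_swap, h1]
  simp only [hφ', mul_neg, integral_neg, neg_inj] at h5
  rw [← integral_sub_left_eq_self _ volume x]
  simp only [sub_sub_cancel]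
  calc _ = ∫ y, u y * fderiv ℝ ρ (x - y) e := by congr 1; ext y; ring
    _ = _ := by rw [h5]; congr 1; ext y; rw [hφ]; ring

theorem mollify_eq_of_ae_eq_const (hc : ∀ᵐ x, R < ‖x‖ → u x = c) {x : EuclideanSpace ℝ (Fin n)}
    (hx : R + (bump n k).rOut ≤ ‖x‖) : mollify k u x = c := by
  have h1 : mollify k u x = mollify k (fun y => if R < ‖y‖ then c else u y) x := by
    refine congrFun (mollify_congr ?_) x
    filter_upwards [hc] with y hy
    split_ifs with h
    · exact hy h
    · rfl
  have hlt : ∀ y ∈ Metric.ball x (bump n k).rOut, R < ‖y‖ := by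
    intro y hy
    rw [Metric.mem_ball, dist_comm, dist_eq_norm] at hy
    have := norm_sub_norm_le x y
    linarith
  rw [h1, mollify, (bump n k).normed_convolution_eq_right]
  · rw [if_pos (hlt x (Metric.mem_ball_self (bump n k).rOut_pos))]
  · intro y hy
    rw [if_pos (hlt y hy), if_pos (hlt x (Metric.mem_ball_self (bump n k).rOut_pos))]

theorem hasCompactSupport_mollify_sub (hc : ∀ᵐ x, R < ‖x‖ → u x = c) :
    HasCompactSupport fun x => mollify k u x - c := by
  refine HasCompactSupport.of_support_subset_isCompact (isCompact_closedBall 0 (R + 2)) ?_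
  intro x hx
  by_contra h
  rw [Metric.mem_closedBall, dist_zero_right, not_le] at h
  refine hx ?_
  have := bump_rOut_le (n := n) (k := k)
  simp only [mollify_eq_of_ae_eq_const (k := k) hc (by linarith : R + (bump n k).rOut ≤ ‖x‖),
    sub_self]

theorem ae_tendsto_mollify (hu : LocallyIntegrable u) :
    ∀ᵐ x, Tendsto (fun k => mollify k u x) atTop (𝓝 (u x)) := by
  refine ContDiffBump.ae_convolution_tendsto_right_of_locallyIntegrable (K := 2)
    tendsto_bump_rOut (Eventually.of_forall fun k => ?_) hu
  change 2 / ((k : ℝ) + 1) ≤ 2 * (1 / ((k : ℝ) + 1))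
  rw [mul_one_div]

theorem locallyIntegrable_of_memLp_two (hg : MemLp g 2) : LocallyIntegrable g :=
  hg.locallyIntegrable (by norm_num)

/-- Mollification is a contraction on `L²`. -/
theorem integral_sq_mollify_le (hg : MemLp g 2) :
    Integrable (fun x => mollify k g x ^ 2) ∧ ∫ x, mollify k g x ^ 2 ≤ ∫ x, g x ^ 2 := by
  have hgl := locallyIntegrable_of_memLp_two hg
  have hg2 : Integrable fun x => g x ^ 2 := (memLp_two_iff_integrable_sq hg.1).1 hg
  have hρ := (bump n k).integrable_normed (μ := (volume : Measure (EuclideanSpace ℝ (Fin n))))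
  have hpt : ∀ x, mollify k g x ^ 2 ≤ mollify k (fun y => g y ^ 2) x := by
    intro x
    set m := mollify k g x with hm
    have i1 := integrable_bump_mul (k := k) hgl x
    have i2 := integrable_bump_mul (k := k) hg2.locallyIntegrable x
    have i12 : Integrable fun t => (bump n k).normed volume t * g (x - t) ^ 2 -
        2 * m * ((bump n k).normed volume t * g (x - t)) := i2.sub (i1.const_mul _)
    -- Jensen's inequality, in the form that a variance is nonnegative.
    have h0 : 0 ≤ ∫ t, (bump n k).normed volume t * (g (x - t) - m) ^ 2 :=
      integral_nonneg fun t => mul_nonneg ((bump n k).nonneg_normed t) (sq_nonneg _)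
    have h1 : ∀ t, (bump n k).normed volume t * (g (x - t) - m) ^ 2 =
        (bump n k).normed volume t * g (x - t) ^ 2 -
          2 * m * ((bump n k).normed volume t * g (x - t)) +
          m ^ 2 * (bump n k).normed volume t := fun t => by ring
    simp_rw [h1] at h0
    rw [integral_add i12 (hρ.const_mul _), integral_sub i2 (i1.const_mul _), integral_const_mul,
      integral_const_mul, (bump n k).integral_normed, ← mollify_apply (u := g),
      ← mollify_apply (u := fun y => g y ^ 2), ← hm] at h0
    nlinarith
  have i3 : Integrable (mollify k fun y => g y ^ 2) := hρ.integrable_convolution (lsmul ℝ ℝ) hg2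
  have h4 : ∫ x, mollify k (fun y => g y ^ 2) x = ∫ x, g x ^ 2 := by
    have := integral_convolution (lsmul ℝ ℝ) hρ hg2
    rw [(bump n k).integral_normed] at this
    simpa [mollify] using this
  have i4 : Integrable fun x => mollify k g x ^ 2 := by
    refine i3.mono' ((contDiff_mollify hgl).continuous.pow 2).aestronglyMeasurable
      (ae_of_all _ fun x => ?_)
    rw [Real.norm_of_nonneg (sq_nonneg _)]
    exact hpt x
  exact ⟨i4, (integral_mono i4 i3 hpt).trans h4.le⟩

/-- Mollifications converge in `L²`. -/
theorem tendsto_integral_sq_mollify_sub (hg : MemLp g 2) :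
    Tendsto (fun k => ∫ x, (mollify k g x - g x) ^ 2) atTop (𝓝 0) := by
  have hgl := locallyIntegrable_of_memLp_two hg
  have hg2 : Integrable fun x => g x ^ 2 := (memLp_two_iff_integrable_sq hg.1).1 hg
  have hmk : ∀ k, MemLp (mollify k g) 2 := fun k =>
    (memLp_two_iff_integrable_sq (contDiff_mollify hgl).continuous.aestronglyMeasurable).2
      (integral_sq_mollify_le hg).1
  have iadd : ∀ k, Integrable fun x => (mollify k g x + g x) ^ 2 := fun k =>
    ((hmk k).add hg).integrable_sq
  have isub : ∀ k, Integrable fun x => (mollify k g x - g x) ^ 2 := fun k =>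
    ((hmk k).sub hg).integrable_sq
  -- The parallelogram identity and contraction bound the difference by `4 ∫ g² - ∫ (gₖ + g)²`;
  -- Fatou applied to `(gₖ + g)² → 4g²` makes this at most `0` in the limit.
  have hpar : ∀ k, ∫ x, (mollify k g x - g x) ^ 2 ≤
      4 * (∫ x, g x ^ 2) - ∫ x, (mollify k g x + g x) ^ 2 := by
    intro k
    have h1 : (∫ x, (mollify k g x - g x) ^ 2) + ∫ x, (mollify k g x + g x) ^ 2 =
        2 * (∫ x, mollify k g x ^ 2) + 2 * ∫ x, g x ^ 2 := by
      rw [← integral_add (isub k) (iadd k), ← integral_const_mul, ← integral_const_mul,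
        ← integral_add ((hmk k).integrable_sq.const_mul 2) (hg2.const_mul 2)]
      congr 1; ext x; ring
    have := (integral_sq_mollify_le (k := k) hg).2
    linarith
  have hfatou : ENNReal.ofReal (4 * ∫ x, g x ^ 2) ≤
      liminf (fun k => ENNReal.ofReal (∫ x, (mollify k g x + g x) ^ 2)) atTop := by
    have h1 : ∀ k, ENNReal.ofReal (∫ x, (mollify k g x + g x) ^ 2) =
        ∫⁻ x, ENNReal.ofReal ((mollify k g x + g x) ^ 2) := fun k =>
      ofReal_integral_eq_lintegral_ofReal (iadd k) (ae_of_all _ fun x => sq_nonneg _)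
    simp_rw [h1]
    refine le_trans (le_of_eq ?_) (lintegral_liminf_le' fun k =>
      (iadd k).aestronglyMeasurable.aemeasurable.ennreal_ofReal)
    rw [← integral_const_mul, ofReal_integral_eq_lintegral_ofReal (hg2.const_mul 4)
      (ae_of_all _ fun x => by positivity)]
    refine lintegral_congr_ae ?_
    filter_upwards [ae_tendsto_mollify hgl] with x hx
    refine (Tendsto.liminf_eq ?_).symm
    have h2 : Tendsto (fun k => (mollify k g x + g x) ^ 2) atTop (𝓝 ((g x + g x) ^ 2)) :=
      (hx.add_const _).pow 2
    have h3 := (ENNReal.continuous_ofReal.tendsto _).comp h2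
    rwa [show (g x + g x) ^ 2 = 4 * g x ^ 2 by ring] at h3
  have hpos : 0 ≤ ∫ x, g x ^ 2 := integral_nonneg fun x => sq_nonneg _
  refine tendsto_order.2 ⟨fun a ha => Eventually.of_forall fun k =>
    ha.trans_le (integral_nonneg fun x => sq_nonneg _), fun a ha => ?_⟩
  -- Strict comparison under `ENNReal.ofReal` needs a positive right side, so `∫ g² = 0` is treated
  -- apart.
  rcases hpos.eq_or_lt with h0 | h0
  · refine Eventually.of_forall fun k => (hpar k).trans_lt ?_
    have : 0 ≤ ∫ x, (mollify k g x + g x) ^ 2 := integral_nonneg fun x => sq_nonneg _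
    rw [← h0]
    linarith
  · have h1 : ENNReal.ofReal (4 * (∫ x, g x ^ 2) - a) <
        liminf (fun k => ENNReal.ofReal (∫ x, (mollify k g x + g x) ^ 2)) atTop :=
      ((ENNReal.ofReal_lt_ofReal_iff (by positivity)).2 (by linarith)).trans_le hfatou
    filter_upwards [eventually_lt_of_lt_liminf h1] with k hk
    have := lt_of_not_ge fun hle => hk.not_ge (ENNReal.ofReal_le_ofReal hle)
    linarith [hpar k]

theorem hasDerivAt_arctan_scaled {m : ℝ} (hm : m ≠ 0) (s : ℝ) :
    HasDerivAt (fun s => m⁻¹ * Real.arctan (m * (s - c))) (1 / (1 + (m * (s - c)) ^ 2)) s := by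
  have h1 : HasDerivAt (fun s => m * (s - c)) m s := by
    simpa using ((hasDerivAt_id s).sub_const c).const_mul m
  refine (h1.arctan.const_mul m⁻¹).congr_deriv ?_
  field_simp

theorem abs_one_div_one_add_sq_le (t : ℝ) : |1 / (1 + t ^ 2)| ≤ 1 := by
  rw [abs_of_nonneg (by positivity), div_le_one (by positivity)]
  nlinarith [sq_nonneg t]

/-- The chain rule for weak derivatives, for a rescaled `arctan`. -/
theorem integral_arctan_mul_fderiv {i : Fin n} (h : HasWeakPartialDeriv i u g) (hg2 : MemLp g 2)
    {m : ℝ} (hm : m ≠ 0) {φ : EuclideanSpace ℝ (Fin n) → ℝ} (hφ : ContDiff ℝ ∞ φ)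
    (hφc : HasCompactSupport φ) :
    ∫ x, m⁻¹ * Real.arctan (m * (u x - c)) * fderiv ℝ φ x (EuclideanSpace.single i 1) =
      -∫ x, 1 / (1 + (m * (u x - c)) ^ 2) * g x * φ x := by
  set e : EuclideanSpace ℝ (Fin n) := EuclideanSpace.single i 1 with he
  have hu := h.1
  have hum := hu.aestronglyMeasurable
  have hU : ∀ k, ContDiff ℝ ∞ (mollify k u) := fun k => contDiff_mollify hu
  have hG : ∀ k, Continuous (mollify k g) := fun k => (contDiff_mollify h.2.1).continuous
  have hUc : ∀ k, Continuous (mollify k u) := fun k => (hU k).continuous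
  have hφ' : Continuous fun x => fderiv ℝ φ x e := (contDiff_fderiv_apply hφ e).continuous
  have hφ'c : HasCompactSupport fun x => fderiv ℝ φ x e := hφc.fderiv_apply ℝ e
  have hcd : Continuous fun s : ℝ => 1 / (1 + (m * (s - c)) ^ 2) :=
    continuous_const.div (by fun_prop) fun s => by positivity
  have hca : Continuous fun s : ℝ => m⁻¹ * Real.arctan (m * (s - c)) :=
    continuous_iff_continuousAt.2 fun s => (hasDerivAt_arctan_scaled hm s).continuousAt
  -- Classical chain rule and integration by parts for the mollification. In the limit the bounded
  -- nonlinear factors converge by dominated convergence, and `mollify k g` converges in `L²`.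
  have hk : ∀ k, ∫ x, m⁻¹ * Real.arctan (m * (mollify k u x - c)) * fderiv ℝ φ x e =
      -∫ x, 1 / (1 + (m * (mollify k u x - c)) ^ 2) * mollify k g x * φ x := by
    intro k
    have hd : ∀ x, HasFDerivAt (fun x => m⁻¹ * Real.arctan (m * (mollify k u x - c)))
        ((1 / (1 + (m * (mollify k u x - c)) ^ 2)) • fderiv ℝ (mollify k u) x) x := fun x =>
      (hasDerivAt_arctan_scaled hm _).comp_hasFDerivAt x
        (((hU k).differentiable (by simp)) x).hasFDerivAt
    have hd' : ∀ x, fderiv ℝ (fun x => m⁻¹ * Real.arctan (m * (mollify k u x - c))) x e =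
        1 / (1 + (m * (mollify k u x - c)) ^ 2) * mollify k g x := fun x => by
      rw [(hd x).fderiv, smul_apply, fderiv_mollify h, smul_eq_mul]
    have hcont1 := hcd.comp (hUc k)
    have hcont2 := hca.comp (hUc k)
    have := integral_mul_fderiv_eq_neg_fderiv_mul_of_integrable
      (μ := (volume : Measure (EuclideanSpace ℝ (Fin n)))) (v := e)
      (f := fun x => m⁻¹ * Real.arctan (m * (mollify k u x - c))) (g := φ)
      (by
        simp only [hd']
        exact ((hcont1.mul (hG k)).mul hφ.continuous).integrable_of_hasCompactSupport
          hφc.mul_left)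
      ((hcont2.mul hφ').integrable_of_hasCompactSupport hφ'c.mul_left)
      ((hcont2.mul hφ.continuous).integrable_of_hasCompactSupport hφc.mul_left)
      (fun x _ => (hd x).differentiableAt) (fun x _ => (hφ.differentiable (by simp)) x)
    simpa only [hd'] using this
  have hum' : AEStronglyMeasurable (fun x => 1 / (1 + (m * (u x - c)) ^ 2)) volume :=
    hcd.comp_aestronglyMeasurable hum
  have hL : Tendsto (fun k => ∫ x, m⁻¹ * Real.arctan (m * (mollify k u x - c)) * fderiv ℝ φ x e)
      atTop (𝓝 (∫ x, m⁻¹ * Real.arctan (m * (u x - c)) * fderiv ℝ φ x e)) := by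
    refine tendsto_integral_of_dominated_convergence
      (fun x => |m⁻¹| * (Real.pi / 2) * |fderiv ℝ φ x e|)
      (fun k => ((hca.comp (hUc k)).mul hφ').aestronglyMeasurable)
      ((hφ'.integrable_of_hasCompactSupport hφ'c).abs.const_mul _)
      (fun k => ae_of_all _ fun x => ?_) ?_
    · rw [norm_mul, norm_mul]
      refine mul_le_mul_of_nonneg_right (mul_le_mul_of_nonneg_left ?_ (abs_nonneg _))
        (abs_nonneg _)
      exact abs_le.2 ⟨(Real.neg_pi_div_two_lt_arctan _).le, (Real.arctan_lt_pi_div_two _).le⟩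
    · filter_upwards [ae_tendsto_mollify hu] with x hx
      exact ((hca.tendsto (u x)).comp hx).mul_const _
  have hφ2 : MemLp φ 2 := hφ.continuous.memLp_of_hasCompactSupport hφc
  have hgφ : Integrable fun x => g x * φ x := hg2.integrable_mul hφ2
  have hmk : ∀ k, MemLp (mollify k g) 2 := fun k =>
    (memLp_two_iff_integrable_sq (hG k).aestronglyMeasurable).2 (integral_sq_mollify_le hg2).1
  have hR1 : Tendsto (fun k => ∫ x, 1 / (1 + (m * (mollify k u x - c)) ^ 2) * (g x * φ x))
      atTop (𝓝 (∫ x, 1 / (1 + (m * (u x - c)) ^ 2) * (g x * φ x))) := by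
    refine tendsto_integral_of_dominated_convergence (fun x => |g x * φ x|)
      (fun k => (hcd.comp (hUc k)).aestronglyMeasurable.mul hgφ.1) hgφ.abs
      (fun k => ae_of_all _ fun x => ?_) ?_
    · rw [norm_mul]
      exact mul_le_of_le_one_left (abs_nonneg _) (abs_one_div_one_add_sq_le _)
    · filter_upwards [ae_tendsto_mollify hu] with x hx
      exact ((hcd.tendsto (u x)).comp hx).mul_const _
  have hidiff : ∀ k, Integrable fun x => (mollify k g x - g x) * φ x := fun k =>
    ((hmk k).sub hg2).integrable_mul hφ2
  have hidiff' : ∀ k, Integrable fun x => 1 / (1 + (m * (mollify k u x - c)) ^ 2) *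
      ((mollify k g x - g x) * φ x) := fun k =>
    (hidiff k).bdd_mul (c := 1) (hcd.comp (hUc k)).aestronglyMeasurable
      (ae_of_all _ fun x => abs_one_div_one_add_sq_le _)
  have hR2 : Tendsto (fun k => ∫ x, 1 / (1 + (m * (mollify k u x - c)) ^ 2) *
      ((mollify k g x - g x) * φ x)) atTop (𝓝 0) := by
    have h1 : Tendsto (fun k => √(∫ x, (mollify k g x - g x) ^ 2) * √(∫ x, φ x ^ 2)) atTop
        (𝓝 0) := by
      have := ((Real.continuous_sqrt.tendsto 0).comp
        (tendsto_integral_sq_mollify_sub hg2)).mul_const (√(∫ x, φ x ^ 2))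
      simpa using this
    refine squeeze_zero_norm (fun k => ?_) h1
    refine (norm_integral_le_of_norm_le (hidiff k).abs (ae_of_all _ fun x => ?_)).trans
      (abs_integral_mul_le_sqrt ((hmk k).sub hg2).1 hφ2.1 ((hmk k).sub hg2).integrable_sq
        hφ2.integrable_sq)
    rw [norm_mul]
    exact mul_le_of_le_one_left (abs_nonneg _) (abs_one_div_one_add_sq_le _)
  have hR : Tendsto (fun k => ∫ x, 1 / (1 + (m * (mollify k u x - c)) ^ 2) * mollify k g x * φ x)
      atTop (𝓝 (∫ x, 1 / (1 + (m * (u x - c)) ^ 2) * g x * φ x)) := by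
    have := hR1.add hR2
    rw [add_zero] at this
    simp_rw [← mul_assoc] at this
    refine this.congr fun k => ?_
    rw [← integral_add]
    · congr 1; ext x; ring
    · have := hgφ.bdd_mul (c := 1) (hcd.comp (hUc k)).aestronglyMeasurable
        (ae_of_all _ fun x => abs_one_div_one_add_sq_le _)
      simpa only [mul_assoc, Function.comp_def] using this
    · simpa only [mul_assoc] using hidiff' k
  exact tendsto_nhds_unique (hL.congr hk) hR.neg

/-- A weak derivative vanishes almost everywhere on the level sets of the function. -/
theorem ae_eq_zero_of_hasWeakPartialDeriv {i : Fin n} (h : HasWeakPartialDeriv i u g)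
    (hg2 : MemLp g 2) (c : ℝ) : ∀ᵐ x, u x = c → g x = 0 := by
  classical
  have hum := h.1.aestronglyMeasurable
  have hcd : ∀ j : ℕ, Continuous fun s : ℝ => 1 / (1 + (((j : ℝ) + 1) * (s - c)) ^ 2) := fun j =>
    continuous_const.div (by fun_prop) fun s => by positivity
  -- The derivative of `m⁻¹ arctan(m(s - c))` tends to the indicator of `{s = c}`, while the
  -- function itself tends uniformly to `0`. The chain rule thus shows that `g` restricted to the
  -- level set integrates to zero against every test function.
  have hlim : ∀ s : ℝ, Tendsto (fun j : ℕ => 1 / (1 + (((j : ℝ) + 1) * (s - c)) ^ 2)) atTop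
      (𝓝 (if s = c then 1 else 0)) := by
    intro s
    split_ifs with hs
    · simp [hs]
    · refine Tendsto.div_atTop tendsto_const_nhds (tendsto_atTop_add_const_left _ _ ?_)
      simp_rw [mul_pow]
      refine Tendsto.atTop_mul_const (by have := sub_ne_zero.2 hs; positivity) ?_
      exact (tendsto_pow_atTop (by norm_num)).comp
        (tendsto_atTop_add_const_right _ _ tendsto_natCast_atTop_atTop)
  set G : EuclideanSpace ℝ (Fin n) → ℝ := fun x => (if u x = c then 1 else 0) * g x with hG
  have hGm : AEStronglyMeasurable G volume :=
    aestronglyMeasurable_of_tendsto_ae atTop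
      (fun j => ((hcd j).comp_aestronglyMeasurable hum).mul hg2.1)
      (ae_of_all _ fun x => (hlim (u x)).mul_const (g x))
  have hGb : ∀ x, ‖G x‖ ≤ ‖g x‖ := by
    intro x
    simp only [hG]
    split_ifs <;> simp
  have hGl : LocallyIntegrable G :=
    locallyIntegrable_of_memLp_two (hg2.mono hGm (ae_of_all _ hGb))
  have hz : ∀ᵐ x, G x = 0 := by
    refine ae_eq_zero_of_integral_contDiff_smul_eq_zero hGl fun φ hφ hφc => ?_
    have hφ2 : MemLp φ 2 := hφ.continuous.memLp_of_hasCompactSupport hφc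
    have hgφ : Integrable fun x => g x * φ x := hg2.integrable_mul hφ2
    have hR : Tendsto (fun j : ℕ => ∫ x, 1 / (1 + (((j : ℝ) + 1) * (u x - c)) ^ 2) * g x * φ x)
        atTop (𝓝 (∫ x, G x * φ x)) := by
      refine tendsto_integral_of_dominated_convergence (fun x => |g x * φ x|)
        (fun j => (((hcd j).comp_aestronglyMeasurable hum).mul hg2.1).mul
          hφ.continuous.aestronglyMeasurable) hgφ.abs
        (fun j => ae_of_all _ fun x => ?_)
        (ae_of_all _ fun x => ((hlim (u x)).mul_const (g x)).mul_const (φ x))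
      rw [mul_assoc, norm_mul]
      exact mul_le_of_le_one_left (abs_nonneg _) (abs_one_div_one_add_sq_le _)
    have hφ' : Continuous fun x => fderiv ℝ φ x (EuclideanSpace.single i 1) :=
      (contDiff_fderiv_apply hφ _).continuous
    have hφ'i : Integrable fun x => fderiv ℝ φ x (EuclideanSpace.single i 1) :=
      hφ'.integrable_of_hasCompactSupport (hφc.fderiv_apply ℝ _)
    have hL : Tendsto (fun j : ℕ => ∫ x, ((j : ℝ) + 1)⁻¹ *
        Real.arctan (((j : ℝ) + 1) * (u x - c)) * fderiv ℝ φ x (EuclideanSpace.single i 1))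
        atTop (𝓝 0) := by
      have h1 : Tendsto (fun j : ℕ => ((j : ℝ) + 1)⁻¹ *
          ∫ x, Real.pi / 2 * |fderiv ℝ φ x (EuclideanSpace.single i 1)|) atTop (𝓝 0) := by
        have := (tendsto_one_div_add_atTop_nhds_zero_nat (𝕜 := ℝ)).mul_const
          (∫ x, Real.pi / 2 * |fderiv ℝ φ x (EuclideanSpace.single i 1)|)
        simpa using this
      refine squeeze_zero_norm (fun j => ?_) h1
      rw [← integral_const_mul]
      refine norm_integral_le_of_norm_le ((hφ'i.abs.const_mul _).const_mul _)
        (ae_of_all _ fun x => ?_)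
      rw [norm_mul, norm_mul, Real.norm_of_nonneg (by positivity : 0 ≤ ((j : ℝ) + 1)⁻¹), mul_assoc]
      refine mul_le_mul_of_nonneg_left (mul_le_mul_of_nonneg_right ?_ (abs_nonneg _))
        (by positivity)
      exact abs_le.2 ⟨(Real.neg_pi_div_two_lt_arctan _).le, (Real.arctan_lt_pi_div_two _).le⟩
    have h2 := tendsto_nhds_unique (hL.congr fun j =>
      integral_arctan_mul_fderiv h hg2 (by positivity) hφ hφc) hR.neg
    simp only [smul_eq_mul]
    simp_rw [mul_comm (φ _)]
    linarith
  filter_upwards [hz] with x hx hux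
  simpa [hG, hux] using hx

/-- Outside a ball on whose complement the function is constant, a weak derivative vanishes. -/
theorem ae_eq_zero_of_ae_eq_const {i : Fin n} (h : HasWeakPartialDeriv i u g)
    (hc : ∀ᵐ x, R < ‖x‖ → u x = c) : ∀ᵐ x, R < ‖x‖ → g x = 0 := by
  -- Almost everywhere `g` is the limit of the derivatives of the mollified `u`, and for large `k`
  -- these mollifications are constant near `x`.
  filter_upwards [ae_tendsto_mollify h.2.1] with x hx hRx
  refine tendsto_nhds_unique hx (tendsto_const_nhds.congr' ?_)
  obtain ⟨δ, hδ, hδx⟩ : ∃ δ > 0, R + δ + δ < ‖x‖ := ⟨(‖x‖ - R) / 3, by linarith, by linarith⟩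
  filter_upwards [(tendsto_order.1 (tendsto_bump_rOut (n := n))).2 δ hδ] with k hk
  have hev : mollify k u =ᶠ[𝓝 x] fun _ => c := by
    filter_upwards [Metric.ball_mem_nhds x hδ] with y hy
    refine mollify_eq_of_ae_eq_const hc ?_
    rw [Metric.mem_ball, dist_comm, dist_eq_norm] at hy
    have := norm_sub_norm_le x y
    linarith
  rw [← fderiv_mollify h, hev.fderiv_eq]
  simp

end Mollify

/-! ### Continuous representative, blow-up and uniform bounds -/

section UniformEstimate

variable {n : ℕ} {u v : EuclideanSpace ℝ (Fin n) → ℝ} {c R : ℝ}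

theorem laplacian_sub_const (v : EuclideanSpace ℝ (Fin n) → ℝ) (c : ℝ)
    (x : EuclideanSpace ℝ (Fin n)) : laplacian (fun y => v y - c) x = laplacian v x := by
  simp only [laplacian, fderiv_sub_const]

theorem laplacian_comp_smul (hv : ContDiff ℝ ∞ v) (r : ℝ) (x : EuclideanSpace ℝ (Fin n)) :
    laplacian (fun z => v (r • z)) x = r ^ 2 * laplacian v (r • x) := by
  have h2 : ∀ z : EuclideanSpace ℝ (Fin n), HasFDerivAt (fun z : EuclideanSpace ℝ (Fin n) => r • z)
      (r • ContinuousLinearMap.id ℝ (EuclideanSpace ℝ (Fin n))) z :=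
    fun z => (hasFDerivAt_id z).const_smul r
  have hd : ∀ (w : EuclideanSpace ℝ (Fin n) → ℝ) (e : EuclideanSpace ℝ (Fin n)),
      ContDiff ℝ ∞ w → ∀ z, fderiv ℝ (fun z => w (r • z)) z e = r * fderiv ℝ w (r • z) e := by
    intro w e hw z
    have := ((hw.differentiable (by simp)) (r • z)).hasFDerivAt.comp z (h2 z)
    have h3 : fderiv ℝ (fun z => w (r • z)) z = _ := this.fderiv
    rw [h3]; simp
  simp only [laplacian, Finset.mul_sum]
  refine Finset.sum_congr rfl fun i _ => ?_
  have h1 := contDiff_fderiv_apply hv (EuclideanSpace.single i (1 : ℝ))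
  have h3 : (fun y => fderiv ℝ (fun z => v (r • z)) y (EuclideanSpace.single i 1)) =
      fun y => (fun y => r * fderiv ℝ v y (EuclideanSpace.single i 1)) (r • y) :=
    funext fun y => hd v _ hv y
  rw [h3, hd _ _ (contDiff_const.mul h1), fderiv_const_mul (h1.differentiable (by simp) _)]
  simp only [smul_apply, smul_eq_mul]
  ring

theorem laplacian_mollify {g : Fin n → EuclideanSpace ℝ (Fin n) → ℝ}
    {h : Fin n → EuclideanSpace ℝ (Fin n) → ℝ}
    (hg : ∀ i, HasWeakPartialDeriv i u (g i)) (hh : ∀ i, HasWeakPartialDeriv i (g i) (h i))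
    (k : ℕ) (x : EuclideanSpace ℝ (Fin n)) :
    laplacian (mollify k u) x = mollify k (fun y => ∑ i, h i y) x := by
  rw [mollify_sum _ fun i => (hh i).2.1]
  refine Finset.sum_congr rfl fun i _ => ?_
  rw [show (fun y => fderiv ℝ (mollify k u) y (EuclideanSpace.single i 1)) = mollify k (g i) from
    funext fun y => fderiv_mollify (hg i) y]
  exact fderiv_mollify (hh i) x

/-- Lets a modulus of continuity that is uniform in `k` pass to a pointwise `limsup`, which exists
even where the mollifications are not known to converge. -/
theorem abs_limsup_sub_limsup_le {a b : ℕ → ℝ} {B δ : ℝ} (ha : ∀ k, |a k| ≤ B)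
    (hb : ∀ k, |b k| ≤ B) (hab : ∀ k, |a k - b k| ≤ δ) :
    |limsup a atTop - limsup b atTop| ≤ δ := by
  have bdd : ∀ {a : ℕ → ℝ} {B : ℝ}, (∀ k, |a k| ≤ B) → atTop.IsBoundedUnder (· ≤ ·) a :=
    fun h => isBoundedUnder_of ⟨_, fun k => (abs_le.1 (h k)).2⟩
  have cobdd : ∀ {a : ℕ → ℝ} {B : ℝ}, (∀ k, |a k| ≤ B) → atTop.IsCoboundedUnder (· ≤ ·) a :=
    fun h => (isBoundedUnder_of ⟨_, fun k => (abs_le.1 (h k)).1⟩ :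
      atTop.IsBoundedUnder (· ≥ ·) _).isCoboundedUnder_le
  have key : ∀ {a b : ℕ → ℝ}, (∀ k, |a k| ≤ B) → (∀ k, |b k| ≤ B) → (∀ k, |a k - b k| ≤ δ) →
      limsup a atTop ≤ limsup b atTop + δ := by
    intro a b ha hb hab
    rw [← limsup_add_const atTop b δ (bdd hb) (cobdd hb)]
    refine limsup_le_limsup (Eventually.of_forall fun k => ?_) (cobdd ha)
      (bdd (B := B + |δ|) fun k => (abs_add_le _ _).trans (add_le_add (hb k) le_rfl))
    have := (abs_le.1 (hab k)).2
    change a k ≤ b k + δ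
    linarith
  have h1 := key ha hb hab
  have h2 := key hb ha fun k => by rw [abs_sub_comm]; exact hab k
  rw [abs_le]
  constructor <;> linarith

theorem uniformContinuous_of_hasCompactSupport_sub (hv : Continuous v)
    (hc : HasCompactSupport fun x => v x - c) : UniformContinuous v := by
  have h1 : UniformContinuous fun x => v x - c :=
    (hv.sub continuous_const).uniformContinuous_of_tendsto_cocompact hc.is_zero_at_infty
  simpa using h1.add (uniformContinuous_const (b := c))

theorem eventually_abs_mollify_sub_le (hv : UniformContinuous v) {δ : ℝ} (hδ : 0 < δ) :
    ∀ᶠ k in atTop, ∀ x, |mollify k v x - v x| ≤ δ := by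
  obtain ⟨η, hη, h⟩ := Metric.uniformContinuous_iff.1 hv δ hδ
  filter_upwards [(tendsto_order.1 (tendsto_bump_rOut (n := n))).2 η hη] with k hk x
  refine (bump n k).dist_normed_convolution_le hv.continuous.aestronglyMeasurable fun y hy => ?_
  exact (h (lt_trans hy hk)).le

/-- A function constant near infinity with square integrable Laplacian has a continuous
representative, in dimension at most three. -/
theorem exists_continuous_representative (hn : n ≤ 3) {F : EuclideanSpace ℝ (Fin n) → ℝ}
    (hu : LocallyIntegrable u) (huc : MemLp (fun x => u x - c) 2) (hF : MemLp F 2)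
    (hlap : ∀ k x, laplacian (mollify k u) x = mollify k F x)
    (hR : ∀ᵐ x, R < ‖x‖ → u x = c) :
    ∃ v : EuclideanSpace ℝ (Fin n) → ℝ, Continuous v ∧ v =ᵐ[volume] u ∧
      ∀ x, R + 2 ≤ ‖x‖ → v x = c := by
  obtain ⟨K, hK, hKa⟩ := exists_abs_le_of_laplacian n hn
  obtain ⟨K', hK', hKa'⟩ := exists_holder_of_laplacian n hn
  set N₁ := √(∫ x, (u x - c) ^ 2) with hN₁
  set N₂ := √(∫ x, F x ^ 2) with hN₂
  have hN₁s : N₁ ^ 2 = ∫ x, (u x - c) ^ 2 := Real.sq_sqrt (integral_nonneg fun x => sq_nonneg _)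
  have hN₂s : N₂ ^ 2 = ∫ x, F x ^ 2 := Real.sq_sqrt (integral_nonneg fun x => sq_nonneg _)
  have hcs : ∀ k, HasCompactSupport fun x => mollify k u x - c :=
    fun k => hasCompactSupport_mollify_sub hR
  have hF2 : ∀ k, ∫ x, mollify k F x ^ 2 ≤ N₂ ^ 2 := fun k =>
    (integral_sq_mollify_le hF).2.trans hN₂s.ge
  have hbound : ∀ k x, |mollify k u x - c| ≤ K * (N₁ + N₂) := by
    intro k
    refine hKa (fun x => mollify k u x - c) ((contDiff_mollify hu).sub contDiff_const) (hcs k) N₁ N₂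
      (Real.sqrt_nonneg _) (Real.sqrt_nonneg _) ?_ ?_
    · have := (integral_sq_mollify_le (k := k) huc).2
      simp only [mollify_sub_const hu] at this
      exact this.trans hN₁s.ge
    · simp only [laplacian_sub_const, hlap]
      exact hF2 k
  set M := K * (N₁ + N₂) + |c| with hM
  have hbd : ∀ k x, |mollify k u x| ≤ M := by
    intro k x
    calc |mollify k u x| = |(mollify k u x - c) + c| := by ring_nf
      _ ≤ _ := (abs_add_le _ _).trans (add_le_add (hbound k x) le_rfl)
  have hFcs : ∀ k, HasCompactSupport (mollify k F) := fun k => by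
    rw [← show laplacian (mollify k u) = mollify k F from funext (hlap k)]
    exact hasCompactSupport_laplacian (hcs k)
  have hholder : ∀ k x y, dist x y ≤ 1 →
      |mollify k u x - mollify k u y| ≤ K' * (M + 0 + N₂) * √(dist x y) := fun k =>
    hKa' (mollify k u) (fun _ => 0) (mollify k F) c M 0 N₂ (contDiff_mollify hu) (hcs k) (hbd k)
      (fun x => by rw [hlap, zero_add]) continuous_const (fun x => by simp)
      (contDiff_mollify (locallyIntegrable_of_memLp_two hF)).continuous (hFcs k)
      (Real.sqrt_nonneg _) (hF2 k)
  -- The `limsup` is defined at every point, agrees with `u` almost everywhere, and inherits the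
  -- Hölder bound common to all mollifications.
  refine ⟨fun x => limsup (fun k => mollify k u x) atTop, ?_, ?_, fun x hx => ?_⟩
  · refine continuous_iff_continuousAt.2 fun x => ?_
    rw [ContinuousAt, tendsto_iff_dist_tendsto_zero]
    have h0 : Tendsto (fun y => K' * (M + 0 + N₂) * √(dist y x)) (𝓝 x) (𝓝 0) := by
      have : Continuous fun y => K' * (M + 0 + N₂) * √(dist y x) := by fun_prop
      simpa using this.tendsto x
    refine squeeze_zero' (Eventually.of_forall fun y => dist_nonneg) ?_ h0
    filter_upwards [Metric.closedBall_mem_nhds x one_pos] with y hy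
    exact abs_limsup_sub_limsup_le (hbd · y) (hbd · x) fun k => hholder k y x hy
  · filter_upwards [ae_tendsto_mollify hu] with x hx
    exact hx.limsup_eq
  · have : ∀ k, mollify k u x = c := fun k =>
      mollify_eq_of_ae_eq_const hR ((add_le_add le_rfl bump_rOut_le).trans hx)
    simp [this]

/-- Uniform sup and Hölder bounds at scale `ε` for functions `u` that are constant `-1` near
infinity and for which `Δu - ε⁻² (u³ - u)` is controlled in `L²`. -/
theorem exists_uniform_estimate (n : ℕ) (hn : n ≤ 3) (A : ℝ) (hA : 0 ≤ A) : ∃ C : ℝ, 0 ≤ C ∧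
    ∀ (ε : ℝ) (u F : EuclideanSpace ℝ (Fin n) → ℝ) (R : ℝ), 0 < ε → ε ≤ 1 →
    LocallyIntegrable u → MemLp (fun x => u x - -1) 2 → MemLp F 2 →
    (∀ k x, laplacian (mollify k u) x = mollify k F x) →
    (∀ᵐ x, R < ‖x‖ → u x = -1) → (∀ᵐ x, R < ‖x‖ → F x = 0) →
    ∫⁻ x, ENNReal.ofReal (ε * (F x - (ε ^ 2)⁻¹ * (u x ^ 3 - u x)) ^ 2) ≤ ENNReal.ofReal (A ^ 2) →
    ∃ v : EuclideanSpace ℝ (Fin n) → ℝ, Continuous v ∧ v =ᵐ[volume] u ∧ (∀ x, |v x| ≤ C) ∧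
      ∀ x y, dist x y ≤ ε → |v x - v y| ≤ C / √ε * √(dist x y) := by
  obtain ⟨K, hK, hKa⟩ := exists_abs_le_of_laplacian_eq_cubic n hn
  obtain ⟨K', hK', hKa'⟩ := exists_holder_of_laplacian n hn
  -- The `1` is the allowance `η` for the commutator of mollification and cubic. Below, `M ^ 3 + M`
  -- bounds the cubic once `|v| ≤ M`.
  set M := K * (2 + 1 + A) with hM
  have hM0 : 0 ≤ M := by positivity
  set C' := K' * (M + (M ^ 3 + M) + A) with hC'
  have hC'0 : 0 ≤ C' := by positivity
  refine ⟨M + C', by positivity, fun ε u F R hε hε1 hu huc hF hlap hR hFR hen => ?_⟩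
  -- Only qualitative continuity is taken from here. The bound `B` below depends on `u` and `ε`, but
  -- it affects only how large `k` must be.
  obtain ⟨v, hvc, hvu, hvR⟩ := exists_continuous_representative hn hu huc hF hlap hR
  have hvcs : HasCompactSupport fun x => v x - -1 := by
    refine HasCompactSupport.of_support_subset_isCompact (isCompact_closedBall 0 (R + 2)) ?_
    intro x hx
    by_contra h
    rw [Metric.mem_closedBall, dist_zero_right, not_le] at h
    exact hx (by simp [hvR x h.le])
  have hvuc := uniformContinuous_of_hasCompactSupport_sub hvc hvcs
  obtain ⟨B, hB⟩ := exists_bound_of_sub_const hvc hvcs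
  have hB0 : 0 ≤ B := (abs_nonneg _).trans (hB 0)
  have hmu : ∀ k, mollify k u = mollify k v := fun k => (mollify_congr hvu).symm
  set P : EuclideanSpace ℝ (Fin n) → ℝ := fun x => (ε ^ 2)⁻¹ * (v x ^ 3 - v x) with hP
  have hPc : Continuous P := by fun_prop
  have hPR : ∀ x, R + 2 ≤ ‖x‖ → P x = 0 := fun x hx => by simp [hP, hvR x hx]; norm_num
  have hPcs : HasCompactSupport P := by
    have := hvcs.comp_left (g := fun t => (ε ^ 2)⁻¹ * ((t + -1) ^ 3 - (t + -1))) (by norm_num)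
    simpa [Function.comp_def, hP] using this
  have hP2 : MemLp P 2 := hPc.memLp_of_hasCompactSupport hPcs
  have hPuc : UniformContinuous P :=
    uniformContinuous_of_hasCompactSupport_sub (c := 0) hPc (by simpa using hPcs)
  set f : EuclideanSpace ℝ (Fin n) → ℝ := fun x => F x - P x with hf
  have hf2 : MemLp f 2 := hF.sub hP2
  have hfl := locallyIntegrable_of_memLp_two hf2
  have hfR : ∀ᵐ x, R + 2 < ‖x‖ → f x = 0 := by
    filter_upwards [hFR] with x hx h
    simp [hf, hPR x h.le, hx (by linarith)]
  have hfcs : ∀ k, HasCompactSupport (mollify k f) := fun k => by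
    simpa using hasCompactSupport_mollify_sub (k := k) hfR
  have hfen : ε * ∫ x, f x ^ 2 ≤ A ^ 2 := by
    rw [← integral_const_mul]
    refine (ENNReal.ofReal_le_ofReal_iff (by positivity)).1 (le_trans (le_of_eq ?_) hen)
    rw [ofReal_integral_eq_lintegral_ofReal (hf2.integrable_sq.const_mul _)
      (ae_of_all _ fun x => by positivity)]
    refine lintegral_congr_ae ?_
    filter_upwards [hvu] with x hx
    simp only [hf, hP, hx]
  have hFk : ∀ k x, mollify k F x = mollify k f x + mollify k P x := by
    intro k x
    rw [← mollify_add hfl hPc.locallyIntegrable]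
    congr 1; ext y; simp [hf]
  have hlapv : ∀ k x, laplacian (mollify k v) x = mollify k P x + mollify k f x := by
    intro k x
    rw [← hmu, hlap, hFk, add_comm]
  have hvl : LocallyIntegrable v := hvc.locallyIntegrable
  have hVs : ∀ k, ContDiff ℝ ∞ fun z => mollify k v (ε • z) := fun k =>
    (contDiff_mollify hvl).comp (contDiff_const_smul ε)
  have hVcs : ∀ k, HasCompactSupport fun z => mollify k v (ε • z) - -1 := fun k => by
    have := hasCompactSupport_mollify_sub (k := k) hR
    rw [hmu] at this
    exact this.comp_smul hε.ne'
  have hVlap : ∀ k z, laplacian (fun z => mollify k v (ε • z)) z =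
      ε ^ 2 * mollify k P (ε • z) + ε ^ 2 * mollify k f (ε • z) := by
    intro k z
    rw [laplacian_comp_smul (contDiff_mollify hvl), hlapv, mul_add]
  have hfkc : ∀ k, Continuous fun z => ε ^ 2 * mollify k f (ε • z) := fun k =>
    continuous_const.mul ((contDiff_mollify hfl).continuous.comp (continuous_const_smul ε))
  have hPkc : ∀ k, Continuous fun z => ε ^ 2 * mollify k P (ε • z) := fun k =>
    continuous_const.mul ((contDiff_mollify hPc.locallyIntegrable).continuous.comp
      (continuous_const_smul ε))
  have hfkcs : ∀ k, HasCompactSupport fun z => ε ^ 2 * mollify k f (ε • z) := fun k =>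
    ((hfcs k).comp_smul hε.ne').mul_left
  -- The scaling gives `ε^(4-n) ∫ f²`, and `ε^(3-n) ≤ 1`, so the energy bound on `ε ∫ f²` suffices.
  have hfkA : ∀ k, ∫ z, (ε ^ 2 * mollify k f (ε • z)) ^ 2 ≤ A ^ 2 := by
    intro k
    have h1 := Measure.integral_comp_smul (volume : Measure (EuclideanSpace ℝ (Fin n)))
      (fun z => (ε ^ 2 * mollify k f z) ^ 2) ε
    rw [h1, finrank_euclideanSpace_fin, abs_of_pos (by positivity), smul_eq_mul]
    simp_rw [mul_pow]
    rw [integral_const_mul]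
    have h2 := (integral_sq_mollify_le (k := k) hf2).2
    have h3 : (ε ^ n)⁻¹ * ε ^ 3 ≤ 1 := by
      rw [inv_mul_le_iff₀ (by positivity), mul_one]
      exact pow_le_pow_of_le_one hε.le hε1 hn
    have h4 : 0 ≤ ε * ∫ x, f x ^ 2 := mul_nonneg hε.le (integral_nonneg fun x => sq_nonneg _)
    calc (ε ^ n)⁻¹ * ((ε ^ 2) ^ 2 * ∫ z, mollify k f z ^ 2)
        ≤ (ε ^ n)⁻¹ * ((ε ^ 2) ^ 2 * ∫ z, f z ^ 2) := by gcongr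
      _ = ((ε ^ n)⁻¹ * ε ^ 3) * (ε * ∫ z, f z ^ 2) := by ring
      _ ≤ 1 * A ^ 2 := by gcongr
      _ = A ^ 2 := one_mul _
  have hlim : ∀ x, Tendsto (fun k => mollify k v x) atTop (𝓝 (v x)) := fun x =>
    ContDiffBump.convolution_tendsto_right_of_continuous tendsto_bump_rOut hvc x
  have hsmul : ∀ x : EuclideanSpace ℝ (Fin n), ε • ε⁻¹ • x = x := fun x => by
    rw [smul_smul, mul_inv_cancel₀ hε.ne', one_smul]
  have hsup : ∀ᶠ k in atTop, ∀ x, |mollify k v x| ≤ M := by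
    -- The commutator splits into `ε² (mollify k P - P)` and `(a³ - a) - (b³ - b) = (a - b)(a² + ab
    -- + b² - 1)`. The last factor is at most `3B² + 1`, so this choice makes each part at most
    -- `1/2`.
    have hδ : 0 < (2 * (3 * B ^ 2 + 1))⁻¹ := by positivity
    filter_upwards [eventually_abs_mollify_sub_le hvuc hδ,
      eventually_abs_mollify_sub_le hPuc (by norm_num : (0 : ℝ) < 1 / 2)] with k h1 h2 x
    have := hKa (fun z => mollify k v (ε • z)) (fun z => ε ^ 2 * mollify k f (ε • z)) (-1) 1 A
      (hVs k) (hVcs k) (fun z => ?_) (hfkc k) (hfkcs k) hA (hfkA k) (ε⁻¹ • x)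
    · simpa only [hsmul] using this
    · rw [hVlap]
      have e1 := h1 (ε • z)
      have e2 := h2 (ε • z)
      set a := mollify k v (ε • z) with ha
      set b := v (ε • z) with hb
      have ha' : |a| ≤ B := abs_mollify_le hB _
      have hb' : |b| ≤ B := hB _
      have hPe : ε ^ 2 * P (ε • z) = b ^ 3 - b := by
        simp only [hP, ← hb]; field_simp
      have e3 : ε ^ 2 * mollify k P (ε • z) + ε ^ 2 * mollify k f (ε • z) - (a ^ 3 - a) -
          ε ^ 2 * mollify k f (ε • z) =
          ε ^ 2 * (mollify k P (ε • z) - P (ε • z)) - (a - b) * (a ^ 2 + a * b + b ^ 2 - 1) := by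
        rw [mul_sub, hPe]; ring
      have e4 : |ε ^ 2 * (mollify k P (ε • z) - P (ε • z))| ≤ 1 / 2 := by
        rw [abs_mul, abs_of_pos (by positivity : 0 < ε ^ 2)]
        have : ε ^ 2 ≤ 1 := pow_le_one₀ hε.le hε1
        calc _ ≤ 1 * (1 / 2 : ℝ) := by gcongr
          _ = _ := one_mul _
      have e5 : |a ^ 2 + a * b + b ^ 2 - 1| ≤ 3 * B ^ 2 + 1 := by
        have q1 : |a * b| ≤ B * B := by rw [abs_mul]; gcongr
        have q2 : a ^ 2 ≤ B ^ 2 := sq_le_sq' (abs_le.1 ha').1 (abs_le.1 ha').2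
        have q3 : b ^ 2 ≤ B ^ 2 := sq_le_sq' (abs_le.1 hb').1 (abs_le.1 hb').2
        rw [abs_le] at q1 ⊢
        constructor <;> nlinarith [sq_nonneg a, sq_nonneg b]
      have e6 : |(a - b) * (a ^ 2 + a * b + b ^ 2 - 1)| ≤ 1 / 2 := by
        rw [abs_mul]
        calc _ ≤ (2 * (3 * B ^ 2 + 1))⁻¹ * (3 * B ^ 2 + 1) := by gcongr
          _ = 1 / 2 := by field_simp
      rw [e3]
      refine (abs_sub _ _).trans ?_
      linarith
  have hvM : ∀ x, |v x| ≤ M := fun x =>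
    le_of_tendsto (hlim x).abs (hsup.mono fun k hk => hk x)
  have hPM : ∀ k z, |ε ^ 2 * mollify k P (ε • z)| ≤ M ^ 3 + M := by
    intro k z
    have h1 : ∀ x, |P x| ≤ (ε ^ 2)⁻¹ * (M ^ 3 + M) := by
      intro x
      rw [hP, abs_mul, abs_of_pos (by positivity : 0 < (ε ^ 2)⁻¹)]
      gcongr
      refine (abs_sub _ _).trans (add_le_add ?_ (hvM x))
      rw [abs_pow]
      exact pow_le_pow_left₀ (abs_nonneg _) (hvM x) 3
    have h2 := abs_mollify_le (k := k) h1 (ε • z)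
    rw [abs_mul, abs_of_pos (by positivity : 0 < ε ^ 2)]
    calc _ ≤ ε ^ 2 * ((ε ^ 2)⁻¹ * (M ^ 3 + M)) := by gcongr
      _ = _ := by field_simp
  refine ⟨v, hvc, hvu, fun x => (hvM x).trans (by linarith), fun x y hxy => ?_⟩
  have hdist : dist (ε⁻¹ • x) (ε⁻¹ • y) = ε⁻¹ * dist x y := by
    rw [dist_smul₀, Real.norm_of_nonneg (by positivity)]
  have h1 : |v x - v y| ≤ C' * √(ε⁻¹ * dist x y) := by
    refine le_of_tendsto ((hlim x).sub (hlim y)).abs ?_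
    filter_upwards [hsup] with k hk
    have := hKa' (fun z => mollify k v (ε • z)) (fun z => ε ^ 2 * mollify k P (ε • z))
      (fun z => ε ^ 2 * mollify k f (ε • z)) (-1) M (M ^ 3 + M) A
      (hVs k) (hVcs k) (fun z => hk _) (hVlap k) (hPkc k) (hPM k) (hfkc k) (hfkcs k) hA (hfkA k)
      (ε⁻¹ • x) (ε⁻¹ • y) (by
        rw [hdist, inv_mul_le_iff₀ hε, mul_one]; exact hxy)
    simpa only [hsmul, hdist] using this
  refine h1.trans ?_
  rw [Real.sqrt_mul (by positivity), Real.sqrt_inv]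
  calc C' * ((√ε)⁻¹ * √(dist x y)) = C' / √ε * √(dist x y) := by ring
    _ ≤ _ := by gcongr; linarith

end UniformEstimate

/-! ### The weak Laplacian and the energy -/

section WeakLaplacian

variable {n : ℕ} {u g g' : EuclideanSpace ℝ (Fin n) → ℝ} {R : ℝ} {i : Fin n}

/-- Needed because `weakLaplacian` iterates arbitrarily chosen derivatives, whereas square
integrability is given for other representatives. -/
theorem HasWeakPartialDeriv.ae_eq (h : HasWeakPartialDeriv i u g)
    (h' : HasWeakPartialDeriv i u g') : g =ᵐ[volume] g' := by
  refine ae_eq_of_integral_contDiff_smul_eq h.2.1 h'.2.1 fun φ hφ hφc => ?_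
  have := (h.2.2 φ hφ hφc).symm.trans (h'.2.2 φ hφ hφc)
  simp only [smul_eq_mul]
  simp_rw [mul_comm (φ _)]
  exact neg_inj.1 this

theorem HasWeakPartialDeriv.congr_left {u' : EuclideanSpace ℝ (Fin n) → ℝ}
    (h : HasWeakPartialDeriv i u g) (hu : u =ᵐ[volume] u') : HasWeakPartialDeriv i u' g := by
  refine ⟨h.1.congr hu, h.2.1, fun φ hφ hφc => ?_⟩
  rw [← h.2.2 φ hφ hφc]
  refine integral_congr_ae ?_
  filter_upwards [hu] with x hx
  rw [hx]

theorem HasWeakPartialDeriv.hasWeakPartialDeriv_weakPartialDeriv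
    (h : HasWeakPartialDeriv i u g) : HasWeakPartialDeriv i u (weakPartialDeriv i u) := by
  have hex : ∃ g, HasWeakPartialDeriv i u g := ⟨g, h⟩
  rw [weakPartialDeriv, dif_pos hex]
  exact hex.choose_spec

theorem memLp_two_of_restrict_closedBall (hg : MemLp g 2 (volume.restrict (Metric.closedBall 0 R)))
    (hz : ∀ᵐ x, R < ‖x‖ → g x = 0) : MemLp g 2 := by
  refine ((memLp_indicator_iff_restrict Metric.isClosed_closedBall.measurableSet).2 hg).ae_eq ?_
  filter_upwards [hz] with x hx
  by_cases h : x ∈ Metric.closedBall 0 R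
  · rw [indicator_of_mem h]
  · rw [indicator_of_notMem h, hx (by simpa using h)]

/-- The weak Laplacian of a `W^{2,2}_loc` function which is constant outside `Ω` is square
integrable, vanishes outside `Ω`, and is compatible with mollification. -/
theorem weakLaplacian_properties [NeZero n] {Ω : Set (EuclideanSpace ℝ (Fin n))}
    (hΩ : Ω ⊆ Metric.closedBall 0 R) (hu : u ∈ phaseFieldSpace Ω) :
    LocallyIntegrable u ∧ MemLp (fun x => u x - -1) 2 ∧ MemLp (weakLaplacian u) 2 ∧
    (∀ k x, laplacian (mollify k u) x = mollify k (weakLaplacian u) x) ∧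
    (∀ᵐ x, R < ‖x‖ → u x = -1) ∧ ∀ᵐ x, x ∉ Ω → weakLaplacian u x = 0 := by
  obtain ⟨⟨hu2, g, h, hg, hh⟩, huΩ⟩ := hu
  -- Local integrability is read off from a first derivative, so at least one coordinate is
  -- required.
  have hul : LocallyIntegrable u := (hg 0).2.1
  have hout : ∀ x : EuclideanSpace ℝ (Fin n), R < ‖x‖ → x ∉ Ω := fun x hx hxΩ => by
    have := hΩ hxΩ
    rw [Metric.mem_closedBall, dist_zero_right] at this
    exact this.not_gt hx
  have huR : ∀ᵐ x, R < ‖x‖ → u x = -1 := huΩ.mono fun x hx hR => hx (hout x hR)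
  have hball := isCompact_closedBall (0 : EuclideanSpace ℝ (Fin n)) R
  have : IsFiniteMeasure (volume.restrict (Metric.closedBall (0 : EuclideanSpace ℝ (Fin n)) R)) :=
    ⟨by simpa using hball.measure_lt_top⟩
  set G : Fin n → EuclideanSpace ℝ (Fin n) → ℝ := fun i => weakPartialDeriv i u with hG
  set H : Fin n → EuclideanSpace ℝ (Fin n) → ℝ := fun i => weakPartialDeriv i (G i) with hH
  have hGw : ∀ i, HasWeakPartialDeriv i u (G i) := fun i =>
    (hg i).2.hasWeakPartialDeriv_weakPartialDeriv
  have hGg : ∀ i, g i =ᵐ[volume] G i := fun i => (hg i).2.ae_eq (hGw i)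
  have hhG : ∀ i, HasWeakPartialDeriv i (G i) (h i i) := fun i => (hh i i).2.congr_left (hGg i)
  have hHw : ∀ i, HasWeakPartialDeriv i (G i) (H i) := fun i =>
    (hhG i).hasWeakPartialDeriv_weakPartialDeriv
  have hHh : ∀ i, h i i =ᵐ[volume] H i := fun i => (hhG i).ae_eq (hHw i)
  have hGR : ∀ i, ∀ᵐ x, R < ‖x‖ → G i x = 0 := fun i => ae_eq_zero_of_ae_eq_const (hGw i) huR
  have hHR : ∀ i, ∀ᵐ x, R < ‖x‖ → H i x = 0 := fun i =>
    ae_eq_zero_of_ae_eq_const (hHw i) (hGR i)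
  have hG2 : ∀ i, MemLp (G i) 2 := fun i => memLp_two_of_restrict_closedBall
    (((hg i).1 _ hball).ae_eq (ae_restrict_of_ae (hGg i))) (hGR i)
  have hH2 : ∀ i, MemLp (H i) 2 := fun i => memLp_two_of_restrict_closedBall
    (((hh i i).1 _ hball).ae_eq (ae_restrict_of_ae (hHh i))) (hHR i)
  refine ⟨hul, ?_, ?_, fun k x => laplacian_mollify hGw hHw k x, huR, ?_⟩
  · refine memLp_two_of_restrict_closedBall ((hu2 _ hball).sub (memLp_const _)) ?_
    filter_upwards [huR] with x hx hR
    simp [hx hR]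
  · exact memLp_finsetSum _ fun i _ => hH2 i
  -- The level-set property is used twice: `u = -1` forces `∂ᵢu = 0`, which forces `∂ᵢ∂ᵢu = 0`.
  -- Locality alone would not cover `∂Ω`, which may have positive measure.
  · filter_upwards [huΩ,
      ae_all_iff.2 fun i => ae_eq_zero_of_hasWeakPartialDeriv (hGw i) (hG2 i) (-1),
      ae_all_iff.2 fun i => ae_eq_zero_of_hasWeakPartialDeriv (hHw i) (hH2 i) 0]
      with x h1 h2 h3 hx
    exact Finset.sum_eq_zero fun i _ => h3 i (h2 i (h1 hx))

theorem deriv_doubleWell (s : ℝ) : deriv doubleWell s = s ^ 3 - s := by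
  have h : HasDerivAt doubleWell (s ^ 3 - s) s := by
    have := ((((hasDerivAt_id s).pow 2).sub_const 1).pow 2).div_const 4
    refine this.congr_deriv ?_
    simp
    ring
  exact h.deriv

theorem surfaceConst_pos : 0 < surfaceConst := by
  have hc : Continuous fun s : ℝ => √(2 * doubleWell s) := by
    unfold doubleWell
    fun_prop
  refine intervalIntegral.intervalIntegral_pos_of_pos_on (hc.intervalIntegrable _ _)
    (fun s hs => Real.sqrt_pos.2 ?_) (by norm_num)
  have : s ^ 2 - 1 ≠ 0 := by nlinarith [hs.1, hs.2]
  unfold doubleWell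
  positivity

/-- A bound on the diffuse Willmore energy controls `Δu - ε⁻² (u³ - u)` in `L²(ℝⁿ)`. -/
theorem lintegral_le_of_diffuseWillmore_le {Ω : Set (EuclideanSpace ℝ (Fin n))} (hΩ : IsOpen Ω)
    (hu : u ∈ phaseFieldSpace Ω) (hz : ∀ᵐ x, x ∉ Ω → weakLaplacian u x = 0) {ε : ℝ} (hε : 0 < ε)
    {a : ℝ} (hW : diffuseWillmore Ω ε u ≤ ENNReal.ofReal a) :
    ∫⁻ x, ENNReal.ofReal (ε * (weakLaplacian u x - (ε ^ 2)⁻¹ * (u x ^ 3 - u x)) ^ 2) ≤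
      ENNReal.ofReal (surfaceConst * a) := by
  rw [diffuseWillmore, if_pos hu] at hW
  have h1 : ∫⁻ x, ENNReal.ofReal (ε * (weakLaplacian u x - (ε ^ 2)⁻¹ * (u x ^ 3 - u x)) ^ 2) =
      ∫⁻ x in Ω, ENNReal.ofReal
        (1 / ε * (ε * weakLaplacian u x - 1 / ε * deriv doubleWell (u x)) ^ 2) := by
    rw [← lintegral_indicator hΩ.measurableSet]
    refine lintegral_congr_ae ?_
    filter_upwards [hz, hu.2] with x h2 h3
    by_cases hx : x ∈ Ω
    · rw [indicator_of_mem hx, deriv_doubleWell]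
      congr 1
      field_simp
    -- Outside `Ω` both terms vanish, since `-1` is a root of `s³ - s`.
    · rw [indicator_of_notMem hx, h2 hx, h3 hx]
      norm_num
  rw [h1]
  have hc := surfaceConst_pos
  calc _ = ENNReal.ofReal surfaceConst * (ENNReal.ofReal (1 / surfaceConst) *
        ∫⁻ x in Ω, ENNReal.ofReal
          (1 / ε * (ε * weakLaplacian u x - 1 / ε * deriv doubleWell (u x)) ^ 2)) := by
        rw [← mul_assoc, ← ENNReal.ofReal_mul hc.le, mul_one_div_cancel hc.ne', ENNReal.ofReal_one,
          one_mul]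
    _ ≤ ENNReal.ofReal surfaceConst * ENNReal.ofReal a := by gcongr
    _ = _ := (ENNReal.ofReal_mul hc.le).symm

end WeakLaplacian

end PhaseField

/-! ### The theorem -/

theorem mainTheorem7 (n : ℕ) (hn : n = 2 ∨ n = 3) (α : ℝ≥0) :
    ∃ C : ℝ≥0, ∀ (Ω : Set (EuclideanSpace ℝ (Fin n))), IsOpen Ω → Bornology.IsBounded Ω →
      ∀ u : ℝ → EuclideanSpace ℝ (Fin n) → ℝ,
        (∀ ε, 0 < ε → u ε ∈ PhaseField.phaseFieldSpace Ω) →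
        limsup (fun ε => PhaseField.diffuseWillmore Ω ε (u ε)) (𝓝[>] (0 : ℝ)) ≤ (α : ℝ≥0∞) →
        ∃ ε₀ : ℝ, 0 < ε₀ ∧ ∀ ε, 0 < ε → ε < ε₀ →
          eLpNorm (u ε) ∞ volume ≤ (C : ℝ≥0∞) ∧
          ∃ v : EuclideanSpace ℝ (Fin n) → ℝ, Continuous v ∧ v =ᵐ[volume] u ε ∧
            ∀ x, ∀ y ∈ Metric.ball x ε, |v x - v y| ≤ C / √ε * √(dist x y) := by
  have hc := PhaseField.surfaceConst_pos
  have hA : 0 ≤ PhaseField.surfaceConst * ((α : ℝ) + 1) := by positivity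
  have hn0 : NeZero n := ⟨by omega⟩
  obtain ⟨C, hC, hmain⟩ := PhaseField.exists_uniform_estimate n (by omega)
    √(PhaseField.surfaceConst * ((α : ℝ) + 1)) (Real.sqrt_nonneg _)
  refine ⟨C.toNNReal, fun Ω hΩ hΩb u hu hlim => ?_⟩
  rw [Real.coe_toNNReal C hC]
  -- A bound on the `limsup` holds for small `ε` only with some slack; hence `α + 1` in the choice
  -- of the constant.
  have hev : ∀ᶠ ε in 𝓝[>] (0 : ℝ), PhaseField.diffuseWillmore Ω ε (u ε) < (α : ℝ≥0∞) + 1 :=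
    eventually_lt_of_limsup_lt
      (hlim.trans_lt (ENNReal.lt_add_right ENNReal.coe_ne_top one_ne_zero))
  obtain ⟨b, hb, hbs⟩ := mem_nhdsGT_iff_exists_Ioo_subset.1 hev
  obtain ⟨R, hR⟩ := hΩb.subset_closedBall 0
  -- The cap at `1` is what the blow-up scaling requires.
  refine ⟨min b 1, lt_min hb one_pos, fun ε hε hε0 => ?_⟩
  obtain ⟨h1, h2, h3, h4, h5, h6⟩ := PhaseField.weakLaplacian_properties hR (hu ε hε)
  have hW : PhaseField.diffuseWillmore Ω ε (u ε) ≤ ENNReal.ofReal ((α : ℝ) + 1) := by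
    have : PhaseField.diffuseWillmore Ω ε (u ε) < (α : ℝ≥0∞) + 1 :=
      hbs ⟨hε, hε0.trans_le (min_le_left _ _)⟩
    rw [ENNReal.ofReal_add α.coe_nonneg zero_le_one, ENNReal.ofReal_coe_nnreal, ENNReal.ofReal_one]
    exact this.le
  have hen := PhaseField.lintegral_le_of_diffuseWillmore_le hΩ (hu ε hε) h6 hε hW
  rw [← Real.sq_sqrt hA] at hen
  have h7 : ∀ᵐ x, R < ‖x‖ → PhaseField.weakLaplacian (u ε) x = 0 := h6.mono fun x hx hRx =>
    hx fun hxΩ => by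
      have := hR hxΩ
      rw [Metric.mem_closedBall, dist_zero_right] at this
      exact this.not_gt hRx
  obtain ⟨v, hv, hvu, hvC, hvh⟩ := hmain ε (u ε) (PhaseField.weakLaplacian (u ε)) R hε
    (hε0.trans_le (min_le_right _ _)).le h1 h2 h3 h4 h5 h7 hen
  refine ⟨?_, v, hv, hvu, fun x y hy => hvh x y (by rw [dist_comm]; exact (Metric.mem_ball.1 hy).le)⟩
  rw [eLpNorm_exponent_top]
  refine eLpNormEssSup_le_of_ae_bound ?_
  filter_upwards [hvu] with x hx
  rw [← hx]
  exact hvC x
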